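/- Let $G=(V,E)$ be a finite simple graph. An asteroidal triple of $G$ is a set of three pairwise non-adjacent vertices such that any two of them are joined by a path containing no vertex of the closed neighbourhood of the third; $G$ is AT-free if it has no asteroidal triple. A PD-set (paired dominating set) of $G$ is a set $D\subseteq V$ such that every vertex of $G$ is in $D$ or adjacent to a vertex of $D$, and the subgraph $G[D]$ induced by $D$ has a perfect matching. For $G$ without isolated vertices, $\gamma_{pr}(G)$ denotes the minimum cardinality of a PD-set of $G$. Theorem. There is an algorithm which, given the adjacency lists (in any order) of a connected AT-free graph $G$ without isolated vertices, with $n$ vertices and $m$ edges, computes in time $O(n+m)$ a PD-set $D$ of $G$ with $|D|\le 2\,\gamma_{pr}(G)$. Here the algorithm is one fixed program for a word RAM (unit-cost assignment, addition, truncated subtraction, comparison and indirect addressing) whose registers and memory cells hold only natural numbers of size $O(n+m)$, that is, words of $\log_2(n+m)+O(1)$ bits. -/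

import Mathlib

/-! ## Paired domination and asteroidal triples -/

namespace PairedDom

variable {V : Type*}

/-- The closed neighbourhood `N[v]`. -/
def closedNbhd (G : SimpleGraph V) (v : V) : Set V := insert v (G.neighborSet v)

/-- `D` is a dominating set: every vertex lies in the closed neighbourhood of a member of `D`. -/
def IsDominating (G : SimpleGraph V) (D : Finset V) : Prop :=
  ∀ v, ∃ u ∈ D, v ∈ closedNbhd G u

/-- `D` is a paired dominating set (PD-set): it is dominating, and the subgraph induced by `D`
has a perfect matching. -/
def IsPDSet (G : SimpleGraph V) (D : Finset V) : Prop :=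
  IsDominating G D ∧ ∃ M : (G.induce (D : Set V)).Subgraph, M.IsPerfectMatching

/-- The paired domination number: the least cardinality of a PD-set (one exists in every finite
graph without isolated vertices). -/
noncomputable def pdNumber (G : SimpleGraph V) : ℕ :=
  sInf {k | ∃ D : Finset V, IsPDSet G D ∧ D.card = k}

/-- There is a path from `p` to `q` that avoids the closed neighbourhood of `r`. -/
def AvoidingPath (G : SimpleGraph V) (p q r : V) : Prop :=
  ∃ P : G.Walk p q, P.IsPath ∧ ∀ w ∈ P.support, w ∉ closedNbhd G r

/-- `{p, q, r}` is an asteroidal triple: an independent set of three vertices such that any two of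
them are joined by a path that avoids the closed neighbourhood of the third. -/
def IsAsteroidalTriple (G : SimpleGraph V) (p q r : V) : Prop :=
  (p ≠ q ∧ q ≠ r ∧ p ≠ r) ∧ (¬ G.Adj p q ∧ ¬ G.Adj q r ∧ ¬ G.Adj p r) ∧
    AvoidingPath G p q r ∧ AvoidingPath G q r p ∧ AvoidingPath G p r q

/-- The graph has no asteroidal triple. -/
def ATFree (G : SimpleGraph V) : Prop := ∀ p q r, ¬ IsAsteroidalTriple G p q r

end PairedDom

/-! ## A word RAM with a step count

The machine has registers and arrays, addressed by constants in the program (so that a program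
uses only finitely many of them); the cell of an array is addressed by the content of a register
(indirect addressing). Registers and cells hold natural numbers. A run is relative to a word bound
`B`: an instruction whose result exceeds `B` cannot be executed. Every instruction and every
evaluation of a test takes one step. -/

namespace WordRAM

/-- Memory contents: `reg x` is register `x`, and `arr a i` is cell `i` of array `a`. -/
structure Mem where
  reg : ℕ → ℕ
  arr : ℕ → ℕ → ℕ

/-- Register `x` receives the value `k`. -/
def Mem.setReg (s : Mem) (x k : ℕ) : Mem :=
  { s with reg := Function.update s.reg x k }

/-- Cell `i` of array `a` receives the value `k`. -/
def Mem.setArr (s : Mem) (a i k : ℕ) : Mem :=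
  { s with arr := Function.update s.arr a (Function.update (s.arr a) i k) }

/-- Tests on two registers. -/
inductive Test where
  | eq (x y : ℕ)
  | lt (x y : ℕ)

/-- The outcome of a test. -/
def Test.Holds (s : Mem) : Test → Prop
  | .eq x y => s.reg x = s.reg y
  | .lt x y => s.reg x < s.reg y

/-- Programs. -/
inductive Prog where
  /-- do nothing -/
  | skip
  /-- register `x` := the constant `k` -/
  | const (x k : ℕ)
  /-- register `x` := register `y` -/
  | move (x y : ℕ)
  /-- register `x` := register `y` + register `z` -/
  | add (x y z : ℕ)
  /-- register `x` := register `y` - register `z`, or `0` if that is negative -/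
  | sub (x y z : ℕ)
  /-- register `x` := cell of array `a` whose index is in register `i` -/
  | load (x a i : ℕ)
  /-- cell of array `a` whose index is in register `i` := register `x` -/
  | store (a i x : ℕ)
  /-- first `p`, then `q` -/
  | seq (p q : Prog)
  /-- if `b` then `p` else `q` -/
  | ite (b : Test) (p q : Prog)
  /-- while `b` do `p` -/
  | loop (b : Test) (p : Prog)

/-- `Exec B p s s' t`: the program `p`, started with memory `s`, halts with memory `s'` after
exactly `t` steps, and writes only numbers that are at most `B`. -/
inductive Exec (B : ℕ) : Prog → Mem → Mem → ℕ → Prop where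
  | skip (s : Mem) : Exec B .skip s s 1
  | const (s : Mem) (x k : ℕ) (h : k ≤ B) : Exec B (.const x k) s (s.setReg x k) 1
  | move (s : Mem) (x y : ℕ) (h : s.reg y ≤ B) :
      Exec B (.move x y) s (s.setReg x (s.reg y)) 1
  | add (s : Mem) (x y z : ℕ) (h : s.reg y + s.reg z ≤ B) :
      Exec B (.add x y z) s (s.setReg x (s.reg y + s.reg z)) 1
  | sub (s : Mem) (x y z : ℕ) (h : s.reg y - s.reg z ≤ B) :
      Exec B (.sub x y z) s (s.setReg x (s.reg y - s.reg z)) 1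
  | load (s : Mem) (x a i : ℕ) (h : s.arr a (s.reg i) ≤ B) :
      Exec B (.load x a i) s (s.setReg x (s.arr a (s.reg i))) 1
  | store (s : Mem) (a i x : ℕ) (h : s.reg x ≤ B) :
      Exec B (.store a i x) s (s.setArr a (s.reg i) (s.reg x)) 1
  | seq {p q : Prog} {s₁ s₂ s₃ : Mem} {t₁ t₂ : ℕ} (h₁ : Exec B p s₁ s₂ t₁)
      (h₂ : Exec B q s₂ s₃ t₂) : Exec B (.seq p q) s₁ s₃ (t₁ + t₂)
  | iteTrue {b : Test} {p q : Prog} {s s' : Mem} {t : ℕ} (hb : b.Holds s)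
      (h : Exec B p s s' t) : Exec B (.ite b p q) s s' (t + 1)
  | iteFalse {b : Test} {p q : Prog} {s s' : Mem} {t : ℕ} (hb : ¬ b.Holds s)
      (h : Exec B q s s' t) : Exec B (.ite b p q) s s' (t + 1)
  | loopDone {b : Test} {p : Prog} {s : Mem} (hb : ¬ b.Holds s) : Exec B (.loop b p) s s 1
  | loopStep {b : Test} {p : Prog} {s₁ s₂ s₃ : Mem} {t₁ t₂ : ℕ} (hb : b.Holds s₁)
      (h₁ : Exec B p s₁ s₂ t₁) (h₂ : Exec B (.loop b p) s₂ s₃ t₂) :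
      Exec B (.loop b p) s₁ s₃ (t₁ + t₂ + 1)

/-- `adj` is an adjacency-list representation of `G`: `adj v` lists the neighbours of `v`, each
once, in an arbitrary order. -/
def IsAdjacencyList {n : ℕ} (G : SimpleGraph (Fin n)) (adj : Fin n → List (Fin n)) : Prop :=
  ∀ v, (adj v).Nodup ∧ ∀ w, w ∈ adj v ↔ G.Adj v w

/-- The initial memory for the adjacency lists `adj`. Register `0` holds the number `n` of
vertices. Array `1` holds the concatenation of the lists of the vertices `0, 1, …, n - 1`, and
for `k ≤ n` cell `k` of array `0` holds the total length of the lists of the vertices below `k`,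
so that the list of vertex `v` begins in cell `arr 0 v` of array `1` and ends before cell
`arr 0 (v + 1)`. Everything else is `0`. -/
def inputMem {n : ℕ} (adj : Fin n → List (Fin n)) : Mem where
  reg := fun x => if x = 0 then n else 0
  arr := fun a i =>
    if a = 0 then
      if i ≤ n then (((List.ofFn adj).take i).map List.length).sum else 0
    else if a = 1 then ((List.ofFn adj).flatten.map Fin.val).getD i 0
    else 0

/-- The set of vertices that is output: `v` belongs to it if cell `v` of array `2` is `1`. -/
def outputSet (n : ℕ) (s : Mem) : Finset (Fin n) :=
  Finset.univ.filter fun v => s.arr 2 v = 1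

end WordRAM

namespace WordRAM

/-! ## Reasoning about programs -/

/-! A connected AT-free graph contains a dominating path that is also a shortest path between two
suitable sets. Two sweeps of partition refinement find it, and a level count shows that it is short
enough.

A sweep grows a queue `Q` from a set `A`. Let `T` be the part of `Q` not yet processed. Choose `y`
outside `Q` with the fewest neighbours in `T`, and move into `Q` every outside vertex that has a
neighbour in `T` not adjacent to `y`. The neighbours in `T` of a vertex that stays outside are among
those of `y`, hence by minimality they are the same. Since `y` itself stays, the final complement
`S` of `Q` is a nonempty module. Moreover, an expelled vertex has an earlier neighbour in `Q` that
is adjacent to no vertex staying outside. Following such neighbours leads from any vertex outside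
`S` to `A` while avoiding `N[y]`, for each of its non-neighbours `y` in `S` (`RefineInv.step`,
`IsFarModule.exists_avoidingWalk`). As long as some outside vertex has no neighbour in `T`, the
rounds are those of breadth-first search. In the first round where every outside vertex has one, the
levels and parents become complete.

The sweep from vertex `0` gives a module `X`, and the sweep from `X` a module `Y`. Following parents
from some `y ∈ Y` gives a path `q 0, …, q d` that ends in `X` and has one vertex on each level. If
`z` were not dominated by it, then `q 0`, `q d`, `z` would be an asteroidal triple. The path itself
avoids `N[z]`; the second sweep joins `z` to `X`, and so to `q d`, avoiding `N[q 0]`; the first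
sweep joins `z` and `q 0` to vertex `0` avoiding `N[q d]` (`IsDescent.dominating`).

If the number of vertices on the path is even, consecutive vertices are paired. Otherwise the end is
paired with a new neighbour, or dropped if it has none. The resulting set has at most `d + 2`
elements. A matched pair of any PD-set dominates vertices on at most four consecutive levels, so `d
+ 1 ≤ 2 * γ`, and parity gains the last unit when `d` is even (`IsDescent.length_le`,
`card_le_of_descent`).

The time is linear because each vertex belongs to `T` in only one round of a sweep, and a round
costs a constant times the number of vertices of `T` plus the sum of their degrees. -/

@[simp] theorem Mem.setReg_reg (s : Mem) (x k y : ℕ) :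
    (s.setReg x k).reg y = if y = x then k else s.reg y := by
  simp [Mem.setReg, Function.update_apply]

@[simp] theorem Mem.setReg_arr (s : Mem) (x k : ℕ) : (s.setReg x k).arr = s.arr := rfl

@[simp] theorem Mem.setArr_reg (s : Mem) (a i k : ℕ) : (s.setArr a i k).reg = s.reg := rfl

@[simp] theorem Mem.setArr_arr (s : Mem) (a i k b : ℕ) :
    (s.setArr a i k).arr b = if b = a then Function.update (s.arr a) i k else s.arr b := by
  simp only [Mem.setArr, Function.update_apply]

/-- The program may write to register `x`. -/
def Prog.writesReg (x : ℕ) : Prog → Bool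
  | .skip => false
  | .const y _ => x == y
  | .move y _ => x == y
  | .add y _ _ => x == y
  | .sub y _ _ => x == y
  | .load y _ _ => x == y
  | .store _ _ _ => false
  | .seq p q => p.writesReg x || q.writesReg x
  | .ite _ p q => p.writesReg x || q.writesReg x
  | .loop _ p => p.writesReg x

/-- The program may write to array `a`. -/
def Prog.writesArr (a : ℕ) : Prog → Bool
  | .store b _ _ => a == b
  | .seq p q => p.writesArr a || q.writesArr a
  | .ite _ p q => p.writesArr a || q.writesArr a
  | .loop _ p => p.writesArr a
  | _ => false

/-- The memories agree on the registers and arrays that `p` does not write. -/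
structure Frame (p : Prog) (s s' : Mem) : Prop where
  reg : ∀ x, p.writesReg x = false → s'.reg x = s.reg x
  arr : ∀ a, p.writesArr a = false → s'.arr a = s.arr a

theorem Frame.refl (p : Prog) (s : Mem) : Frame p s s := ⟨fun _ _ => rfl, fun _ _ => rfl⟩

theorem Frame.trans {p : Prog} {s₁ s₂ s₃ : Mem} (h : Frame p s₁ s₂) (h' : Frame p s₂ s₃) :
    Frame p s₁ s₃ :=
  ⟨fun x hx => (h'.reg x hx).trans (h.reg x hx), fun a ha => (h'.arr a ha).trans (h.arr a ha)⟩

theorem Frame.mono {p q : Prog} {s s' : Mem} (h : Frame p s s')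
    (hr : ∀ x, q.writesReg x = false → p.writesReg x = false)
    (ha : ∀ a, q.writesArr a = false → p.writesArr a = false) : Frame q s s' :=
  ⟨fun x hx => h.reg x (hr x hx), fun a hx => h.arr a (ha a hx)⟩

/-- Since the write sets are computed as Booleans, this turns the preservation of any untouched
register or array in a concrete program into a proof by `rfl`. -/
theorem Exec.frame {B : ℕ} {p : Prog} {s s' : Mem} {t : ℕ} (h : Exec B p s s' t) :
    Frame p s s' := by
  induction h with
  | skip s => exact Frame.refl _ _
  | const s x k h => constructor <;> simp +contextual [Prog.writesReg]
  | move s x y h => constructor <;> simp +contextual [Prog.writesReg]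
  | add s x y z h => constructor <;> simp +contextual [Prog.writesReg]
  | sub s x y z h => constructor <;> simp +contextual [Prog.writesReg]
  | load s x a i h => constructor <;> simp +contextual [Prog.writesReg]
  | store s a i x h => constructor <;> simp +contextual [Prog.writesArr]
  | seq _ _ ih₁ ih₂ =>
    exact (ih₁.mono (by simp +contextual [Prog.writesReg]) (by simp +contextual
      [Prog.writesArr])).trans
      (ih₂.mono (by simp +contextual [Prog.writesReg]) (by simp +contextual [Prog.writesArr]))
  | iteTrue _ _ ih =>
    exact ih.mono (by simp +contextual [Prog.writesReg]) (by simp +contextual [Prog.writesArr])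
  | iteFalse _ _ ih =>
    exact ih.mono (by simp +contextual [Prog.writesReg]) (by simp +contextual [Prog.writesArr])
  | loopDone _ => exact Frame.refl _ _
  | loopStep _ _ _ ih₁ ih₂ =>
    exact (ih₁.mono (by simp [Prog.writesReg]) (by simp [Prog.writesArr])).trans ih₂

/-- Started in `s`, the program halts after at most `T` steps in a memory that satisfies `Q`. -/
def Runs (B : ℕ) (p : Prog) (s : Mem) (T : ℕ) (Q : Mem → Prop) : Prop :=
  ∃ s' t, Exec B p s s' t ∧ t ≤ T ∧ Q s'

theorem Runs.mono {B : ℕ} {p : Prog} {s : Mem} {T T' : ℕ} {Q Q' : Mem → Prop}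
    (h : Runs B p s T Q) (hT : T ≤ T') (hQ : ∀ s', Frame p s s' → Q s' → Q' s') :
    Runs B p s T' Q' := by
  obtain ⟨s', t, he, ht, hq⟩ := h
  exact ⟨s', t, he, ht.trans hT, hQ s' he.frame hq⟩

theorem Runs.seq {B : ℕ} {p q : Prog} {s : Mem} {T₁ T₂ T : ℕ} {Q₁ Q : Mem → Prop}
    (h₁ : Runs B p s T₁ Q₁) (h₂ : ∀ s', Frame p s s' → Q₁ s' → Runs B q s' T₂ Q)
    (hT : T₁ + T₂ ≤ T) : Runs B (.seq p q) s T Q := by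
  obtain ⟨s', t, he, ht, hq⟩ := h₁
  obtain ⟨s'', t', he', ht', hq'⟩ := h₂ s' he.frame hq
  exact ⟨s'', t + t', .seq he he', by omega, hq'⟩

theorem Runs.ite {B : ℕ} {b : Test} {p q : Prog} {s : Mem} {T : ℕ} {Q : Mem → Prop}
    (h₁ : b.Holds s → Runs B p s T Q) (h₂ : ¬ b.Holds s → Runs B q s T Q) :
    Runs B (.ite b p q) s (T + 1) Q := by
  by_cases hb : b.Holds s
  · obtain ⟨s', t, he, ht, hq⟩ := h₁ hb
    exact ⟨s', t + 1, .iteTrue hb he, by omega, hq⟩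
  · obtain ⟨s', t, he, ht, hq⟩ := h₂ hb
    exact ⟨s', t + 1, .iteFalse hb he, by omega, hq⟩

/-- A bound for the number of steps of a loop-free program. -/
def Prog.cost : Prog → ℕ
  | .seq p q => p.cost + q.cost
  | .ite _ p q => max p.cost q.cost + 1
  | _ => 1

/-- The weakest precondition of a loop-free program. -/
def Prog.wp (B : ℕ) : Prog → (Mem → Prop) → Mem → Prop
  | .skip, Q, s => Q s
  | .const x k, Q, s => k ≤ B ∧ Q (s.setReg x k)
  | .move x y, Q, s => s.reg y ≤ B ∧ Q (s.setReg x (s.reg y))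
  | .add x y z, Q, s => s.reg y + s.reg z ≤ B ∧ Q (s.setReg x (s.reg y + s.reg z))
  | .sub x y z, Q, s => s.reg y - s.reg z ≤ B ∧ Q (s.setReg x (s.reg y - s.reg z))
  | .load x a i, Q, s => s.arr a (s.reg i) ≤ B ∧ Q (s.setReg x (s.arr a (s.reg i)))
  | .store a i x, Q, s => s.reg x ≤ B ∧ Q (s.setArr a (s.reg i) (s.reg x))
  | .seq p q, Q, s => p.wp B (q.wp B Q) s
  | .ite b p q, Q, s => (b.Holds s → p.wp B Q s) ∧ (¬ b.Holds s → q.wp B Q s)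
  | .loop _ _, _, _ => False

/-- The precondition of a loop is `False`, so the constant bound `Prog.cost` is claimed for
loop-free code only. -/
theorem Runs.of_wp {B : ℕ} {p : Prog} {s : Mem} {Q : Mem → Prop} (h : p.wp B Q s) :
    Runs B p s p.cost Q := by
  induction p generalizing s Q with
  | skip => exact ⟨_, _, .skip s, le_rfl, h⟩
  | const x k => exact ⟨_, _, .const s x k h.1, le_rfl, h.2⟩
  | move x y => exact ⟨_, _, .move s x y h.1, le_rfl, h.2⟩
  | add x y z => exact ⟨_, _, .add s x y z h.1, le_rfl, h.2⟩
  | sub x y z => exact ⟨_, _, .sub s x y z h.1, le_rfl, h.2⟩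
  | load x a i => exact ⟨_, _, .load s x a i h.1, le_rfl, h.2⟩
  | store a i x => exact ⟨_, _, .store s a i x h.1, le_rfl, h.2⟩
  | seq p q ihp ihq => exact (ihp h).seq (fun s' _ hs' => ihq hs') le_rfl
  | ite b p q ihp ihq =>
    exact Runs.ite (fun hb => (ihp (h.1 hb)).mono (le_max_left _ _) fun _ _ h => h)
      (fun hb => (ihq (h.2 hb)).mono (le_max_right _ _) fun _ _ h => h)
  | loop b p => exact h.elim

theorem Runs.wp_seq {B : ℕ} {p q : Prog} {s : Mem} {T T' : ℕ} {Q : Mem → Prop}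
    (h : p.wp B (fun s' => Runs B q s' T Q) s) (hT : p.cost + T ≤ T') :
    Runs B (.seq p q) s T' Q :=
  (Runs.of_wp h).seq (fun _ _ h => h) hT

/-- Loops, with a potential `Φ` that pays for the running time. -/
theorem Runs.loop {B : ℕ} {b : Test} {p : Prog} (I : Mem → Prop) (Φ : Mem → ℕ) {s₀ : Mem}
    (h₀ : I s₀)
    (step : ∀ s, Frame p s₀ s → I s → b.Holds s →
      ∃ T, Runs B p s T fun s' => I s' ∧ Φ s' + T + 1 ≤ Φ s) :
    Runs B (.loop b p) s₀ (Φ s₀ + 1) fun s' => I s' ∧ ¬ b.Holds s' := by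
  -- The number of iterations is unknown in advance, so the induction runs over a bound for the
  -- potential, which drops by at least one in each iteration.
  suffices H : ∀ N s, Φ s ≤ N → Frame p s₀ s → I s →
      Runs B (.loop b p) s (Φ s + 1) fun s' => I s' ∧ ¬ b.Holds s' from
    H _ s₀ le_rfl (Frame.refl _ _) h₀
  intro N
  induction N with
  | zero =>
    intro s hN hf hI
    by_cases hb : b.Holds s
    · obtain ⟨T, s', t, he, ht, hI', hΦ⟩ := step s hf hI hb
      omega
    · exact ⟨s, 1, .loopDone hb, by omega, hI, hb⟩
  | succ N ih =>
    intro s hN hf hI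
    by_cases hb : b.Holds s
    · obtain ⟨T, s', t, he, ht, hI', hΦ⟩ := step s hf hI hb
      obtain ⟨s'', t', he', ht', hq⟩ := ih s' (by omega) (hf.trans he.frame) hI'
      exact ⟨s'', t + t' + 1, .loopStep hb he he', by omega, hq⟩
    · exact ⟨s, 1, .loopDone hb, by omega, hI, hb⟩

/-- `for` register `ri` from its present value to the content of register `rk` (excluded). Register
`1` is expected to hold the number `1`. -/
def Prog.range (ri rk : ℕ) (body : Prog) : Prog :=
  .loop (.lt ri rk) (.seq body (.add ri ri 1))

/-- The potential is the cost still to come. Each iteration adds two steps to the body, one for the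
test and one for the increment. -/
theorem Runs.range {B ri rk : ℕ} {body : Prog} {s₀ : Mem} (I : ℕ → Mem → Prop) (f : ℕ → ℕ)
    {a b : ℕ} (ha : s₀.reg ri = a) (hb : s₀.reg rk = b) (hab : a ≤ b) (hB : b ≤ B)
    (h1 : s₀.reg 1 = 1) (hrk : rk ≠ ri) (hr1 : ri ≠ 1)
    (wi : body.writesReg ri = false) (wk : body.writesReg rk = false)
    (w1 : body.writesReg 1 = false) (h₀ : I a s₀)
    (hI : ∀ i s k, I i s → I i (s.setReg ri k))
    (step : ∀ i s, a ≤ i → i < b → Frame (.range ri rk body) s₀ s → s.reg ri = i → I i s →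
      Runs B body s (f i) (I (i + 1))) :
    Runs B (.range ri rk body) s₀ ((∑ i ∈ Finset.Ico a b, (f i + 2)) + 1) (I b) := by
  have key := Runs.loop (B := B) (b := .lt ri rk) (p := .seq body (.add ri ri 1))
    (fun s => a ≤ s.reg ri ∧ s.reg ri ≤ b ∧ I (s.reg ri) s)
    (fun s => ∑ i ∈ Finset.Ico (s.reg ri) b, (f i + 2)) (s₀ := s₀)
    ⟨ha.ge, ha.trans_le hab, ha.symm ▸ h₀⟩ ?_
  · rw [ha] at key
    refine key.mono le_rfl ?_
    rintro s' hf ⟨⟨h2, h3, h4⟩, h5⟩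
    have hk : s'.reg rk = b := by
      rw [hf.reg rk (by simpa [Prog.writesReg, wk] using hrk), hb]
    have : s'.reg ri = b := le_antisymm h3 (by simpa [Test.Holds, hk] using h5)
    rwa [this] at h4
  · rintro s hf ⟨h2, h3, h4⟩ hlt
    have hk : s.reg rk = b := by
      rw [hf.reg rk (by simpa [Prog.writesReg, wk] using hrk), hb]
    have h1' : s.reg 1 = 1 := by
      rw [hf.reg 1 (by simpa [Prog.writesReg, w1] using hr1.symm), h1]
    have hlt' : s.reg ri < b := by simpa [Test.Holds, hk] using hlt
    refine ⟨f (s.reg ri) + 1,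
      (step (s.reg ri) s h2 hlt' (hf.mono (fun _ h => h) (fun _ h => h)) rfl h4).seq
      (T₂ := 1) ?_ le_rfl⟩
    intro s' hf' hI'
    have hi : s'.reg ri = s.reg ri := hf'.reg ri wi
    have h1'' : s'.reg 1 = 1 := (hf'.reg 1 w1).trans h1'
    refine Runs.of_wp (p := .add ri ri 1) ⟨?_, ?_⟩
    · rw [hi, h1'']; omega
    · rw [hi, h1'']
      simp only [Mem.setReg_reg, if_true]
      refine ⟨⟨by omega, by omega, hI _ _ _ hI'⟩, ?_⟩
      rw [Finset.sum_eq_sum_Ico_succ_bot hlt' (fun i => f i + 2)]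
      omega

/-- `for` every entry of the array `a`, from the cell whose index is in register `ri` to the cell
before the one whose index is in register `rk`: put it into register `x`, and do `body`. -/
def Prog.scan (ri rk x a : ℕ) (body : Prog) : Prog :=
  .range ri rk (.seq (.load x a ri) body)

/-- The invariant is indexed by the prefix of the list already scanned. The body may write to the
scanned array as long as the scanned cells keep their contents (`hstab`); this allows a queue to
grow while it is being read. -/
theorem Runs.scan {B ri rk x a : ℕ} {body : Prog} {s₀ : Mem} (I : List ℕ → Mem → Prop)
    (f : ℕ → ℕ) {i₀ : ℕ} {L : List ℕ} (ha : s₀.reg ri = i₀) (hb : s₀.reg rk = i₀ + L.length)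
    (hB : i₀ + L.length ≤ B) (h1 : s₀.reg 1 = 1) (hL : ∀ v ∈ L, v ≤ B)
    (harr : ∀ i (h : i < L.length), s₀.arr a (i₀ + i) = L[i])
    (hrk : rk ≠ ri) (hr1 : ri ≠ 1) (hxi : ri ≠ x) (hxk : rk ≠ x) (hx1 : 1 ≠ x)
    (wi : body.writesReg ri = false) (wk : body.writesReg rk = false)
    (w1 : body.writesReg 1 = false) (h₀ : I [] s₀)
    (hI : ∀ l s k, I l s → I l (s.setReg ri k) ∧ I l (s.setReg x k))
    (hstab : ∀ l s, Frame (.scan ri rk x a body) s₀ s → I l s →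
      ∀ i < L.length, s.arr a (i₀ + i) = s₀.arr a (i₀ + i))
    (step : ∀ l v l' s, L = l ++ v :: l' → Frame (.scan ri rk x a body) s₀ s → I l s →
      s.reg x = v → Runs B body s (f v) (I (l ++ [v]))) :
    Runs B (.scan ri rk x a body) s₀ ((L.map fun v => f v + 3).sum + 1) (I L) := by
  have key := Runs.range (B := B) (ri := ri) (rk := rk) (body := .seq (.load x a ri) body)
    (s₀ := s₀) (fun i s => I (L.take (i - i₀)) s)
    (fun i => if h : i - i₀ < L.length then f L[i - i₀] + 1 else 0) ha hb (by omega) hB h1 hrk hr1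
    (by simp [Prog.writesReg, wi, hxi]) (by simp [Prog.writesReg, wk, hxk])
    (by simp [Prog.writesReg, w1, hx1]) (by simpa using h₀) (fun i s k h => (hI _ _ _ h).1) ?_
  · refine key.mono ?_ (fun s' _ h => by simpa using h)
    rw [Finset.sum_Ico_eq_sum_range, Nat.add_sub_cancel_left]
    simp only [Nat.add_sub_cancel_left, add_le_add_iff_right]
    rw [← Fin.sum_univ_eq_sum_range
      (fun i => (if h : i < L.length then f L[i] + 1 else 0) + 2) L.length,
      ← Fin.sum_univ_fun_getElem]
    simp
  · intro i s hi hib hf hri hIs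
    have hlt : i - i₀ < L.length := by omega
    have hv : s.arr a i = L[i - i₀] := by
      have h2 := hstab _ s hf hIs (i - i₀) hlt
      have h3 := harr (i - i₀) hlt
      rw [h3, Nat.add_sub_cancel' hi] at h2
      exact h2
    simp only [hlt, dif_pos]
    refine Runs.wp_seq (p := .load x a ri) (T := f L[i - i₀]) ?_ (by simp [Prog.cost, add_comm])
    simp only [Prog.wp]
    rw [hri, hv]
    refine ⟨hL _ (List.getElem_mem _), ?_⟩
    have := step (L.take (i - i₀)) L[i - i₀] (L.drop (i - i₀ + 1)) (s.setReg x L[i - i₀])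
      (by rw [List.cons_getElem_drop_succ, List.take_append_drop])
      (hf.trans ⟨fun y hy => ?_, fun _ _ => rfl⟩) (hI _ _ _ hIs).2 (by simp)
    · refine this.mono le_rfl (fun s' _ h => ?_)
      rwa [List.take_append_getElem, ← Nat.sub_add_comm hi] at h
    · have : y ≠ x := by
        rintro rfl
        simp [Prog.range, Prog.writesReg] at hy
      simp [this]

/-! ## Lists in memory -/

/-- The cells of `f` from index `i₀` on hold the list `L`. -/
def Stores (f : ℕ → ℕ) (i₀ : ℕ) (L : List ℕ) : Prop :=
  ∀ i (h : i < L.length), f (i₀ + i) = L[i]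

theorem Stores.nil (f : ℕ → ℕ) (i₀ : ℕ) : Stores f i₀ [] := fun _ h => absurd h (by simp)

theorem Stores.snoc {f : ℕ → ℕ} {i₀ : ℕ} {L : List ℕ} (h : Stores f i₀ L) (v : ℕ) :
    Stores (Function.update f (i₀ + L.length) v) i₀ (L ++ [v]) := by
  intro i hi
  rw [Function.update_apply]
  rw [List.length_append, List.length_singleton] at hi
  split_ifs with hc
  · obtain rfl : i = L.length := by omega
    simp
  · rw [h i (by omega), List.getElem_append_left]

theorem Stores.drop {f : ℕ → ℕ} {L : List ℕ} (h : Stores f 0 L) (a : ℕ) :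
    Stores f a (L.drop a) := by
  intro i hi
  rw [List.length_drop] at hi
  have := h (a + i) (by omega)
  simpa using this

/-- `adj` consists of the adjacency lists of a graph with the vertices `0, …, n - 1`. -/
structure AdjLists (n : ℕ) (adj : ℕ → List ℕ) : Prop where
  nodup : ∀ t, (adj t).Nodup
  lt : ∀ {t v}, v ∈ adj t → v < n
  symm : ∀ {t v}, v ∈ adj t → t ∈ adj v
  irrefl : ∀ t, t ∉ adj t

/-- The memory holds the adjacency lists as in `inputMem`; register `1` contains the number `1`,
register `2` the number `0`. -/
structure HasInput (B n : ℕ) (adj : ℕ → List ℕ) (s : Mem) : Prop where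
  reg0 : s.reg 0 = n
  reg1 : s.reg 1 = 1
  reg2 : s.reg 2 = 0
  succ_le : n + 1 ≤ B
  off_succ : ∀ t < n, s.arr 0 (t + 1) = s.arr 0 t + (adj t).length
  off_le : ∀ t ≤ n, s.arr 0 t ≤ B
  stores : ∀ t < n, Stores (s.arr 1) (s.arr 0 t) (adj t)

theorem HasInput.frame {B n : ℕ} {adj : ℕ → List ℕ} {s s' : Mem} (h : HasInput B n adj s)
    {p : Prog} (hf : Frame p s s') (h0 : p.writesReg 0 = false) (h1 : p.writesReg 1 = false)
    (h2 : p.writesReg 2 = false) (h3 : p.writesArr 0 = false) (h4 : p.writesArr 1 = false) :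
    HasInput B n adj s' := by
  obtain ⟨a, b, c, d, e, f, g⟩ := h
  rw [← hf.reg 0 h0] at a
  rw [← hf.reg 1 h1] at b
  rw [← hf.reg 2 h2] at c
  rw [← hf.arr 0 h3] at e f g
  rw [← hf.arr 1 h4] at g
  exact ⟨a, b, c, d, e, f, g⟩

/-! ## The refinement program

Registers: `0` number of vertices, `1` one, `2` zero, `3` and `4` ends of the part of the queue that
is being processed, `5` end of the queue, `6` number of touched vertices, `7` index of the outer
loop, `8` current vertex, `9` and `10` index and end of the loop through its list, `11` its
neighbour, `12`, `14`, `15`, `16` auxiliary, `13` the chosen vertex.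

Arrays: `0` and `1` input, `3` indicator function of the vertices outside the queue, `4` the queue,
`5` the touched vertices, `6` counters, `7` parents, increased by one. -/

/-- Execute `body` for all neighbours (in register `11`) of the vertex in register `8`. -/
def scanAdj (body : Prog) : Prog :=
  .seq (.load 9 0 8) <| .seq (.add 10 8 1) <| .seq (.load 10 0 10) <| .scan 9 10 11 1 body

/-- Execute `body` for all vertices (in register `8`) of the present part of the queue. -/
def scanQueue (body : Prog) : Prog :=
  .seq (.move 7 3) <| .scan 7 4 8 4 body

/-- Execute `body` for all touched vertices (in register `11`). -/
def scanTouched (body : Prog) : Prog :=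
  .seq (.const 7 0) <| .scan 7 6 11 5 body

/-- Count the edge from the vertex in register `8` to the one in register `11`. -/
def touchBody : Prog :=
  .seq (.load 12 3 11) <| .ite (.eq 12 1)
    (.seq (.load 12 6 11) <|
      .seq (.ite (.eq 12 2)
        (.seq (.store 5 6 11) <| .seq (.add 6 6 1) <| .seq (.load 16 7 11) <|
          .ite (.eq 16 2) (.seq (.add 16 8 1) (.store 7 11 16)) .skip)
        .skip) <|
      .seq (.add 12 12 1) (.store 6 11 12))
    .skip

/-- Count for every vertex outside the queue its neighbours in the present part of the queue. -/
def touch : Prog := .seq (.const 6 0) <| scanQueue (scanAdj touchBody)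

/-- If all vertices outside the queue are touched, choose one with the smallest counter. -/
def choose : Prog :=
  .seq (.add 16 6 4) <| .ite (.eq 16 0)
    (.seq (.load 13 5 2) <| .seq (.load 14 6 13) <| scanTouched
      (.seq (.load 12 6 11) <| .ite (.lt 12 14) (.seq (.move 13 11) (.move 14 12)) .skip))
    (.move 13 0)

/-- Set all counters to zero. -/
def resetCounters : Prog := scanTouched (.store 6 11 2)

/-- Append the vertex in register `11` to the queue unless it is there. -/
def expelBody : Prog :=
  .seq (.load 12 3 11) <| .ite (.eq 12 1)
    (.seq (.store 3 11 2) <| .seq (.store 4 5 11) (.add 5 5 1)) .skip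

/-- Append to the queue all neighbours of those vertices of the present part of the queue that are
not adjacent to the chosen vertex. -/
def expel : Prog :=
  scanQueue <|
    .seq (.const 15 0) <| .seq (scanAdj (.ite (.eq 11 13) (.move 15 1) .skip)) <|
      .ite (.eq 15 2) (scanAdj expelBody) .skip

/-- One round of the refinement. -/
def refineRound : Prog :=
  .seq touch <| .seq choose <| .seq resetCounters <| .seq expel <| .seq (.move 3 4) (.move 4 5)

/-- Initialize the queue with the vertices that are marked in array `3`. -/
def refineInit : Prog :=
  .seq (.const 5 0) <| .seq (.const 7 0) <| .seq
    (.range 7 0 <| .seq (.load 12 3 7) <| .seq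
      (.ite (.eq 12 1) (.seq (.store 3 7 2) <| .seq (.store 4 5 7) (.add 5 5 1)) (.store 3 7 1))
      (.store 7 7 2)) <|
    .seq (.const 3 0) (.move 4 5)

/-- Starting from the set of the vertices marked in array `3`, find a module far away from it. -/
def refineSet : Prog := .seq refineInit <| .loop (.lt 3 4) refineRound

/-! ### Loops over adjacency lists, the queue and the touched vertices -/

variable {B n : ℕ} {adj : ℕ → List ℕ}

theorem HasInput.off_add_le {s : Mem} (h : HasInput B n adj s) {t : ℕ} (ht : t < n) :
    s.arr 0 t + (adj t).length ≤ B := by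
  rw [← h.off_succ t ht]
  exact h.off_le _ ht

theorem Runs.scanAdj {body : Prog} {s₀ : Mem} (hA : AdjLists n adj) (hin : HasInput B n adj s₀)
    {t : ℕ} (ht : s₀.reg 8 = t) (htn : t < n) (I : List ℕ → Mem → Prop) (c : ℕ)
    (w1 : body.writesReg 1 = false) (w9 : body.writesReg 9 = false)
    (w10 : body.writesReg 10 = false) (wa : body.writesArr 1 = false) (h₀ : I [] s₀)
    (hI : ∀ l s k, I l s → I l (s.setReg 9 k) ∧ I l (s.setReg 10 k) ∧ I l (s.setReg 11 k))
    (step : ∀ l v l' s, adj t = l ++ v :: l' → Frame (scanAdj body) s₀ s → I l s →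
      s.reg 11 = v → Runs B body s c (I (l ++ [v]))) :
    Runs B (scanAdj body) s₀ ((adj t).length * (c + 3) + 4) (I (adj t)) := by
  have hoff := hin.off_add_le htn
  unfold WordRAM.scanAdj
  refine Runs.wp_seq (p := .load 9 0 8) (T := (adj t).length * (c + 3) + 3) ?_
    (by simp [Prog.cost]; omega)
  refine ⟨by rw [ht]; omega, Runs.wp_seq (p := .add 10 8 1)
    (T := (adj t).length * (c + 3) + 2) ?_ (by simp [Prog.cost]; omega)⟩
  refine ⟨?_, Runs.wp_seq (p := .load 10 0 10)
    (T := (adj t).length * (c + 3) + 1) ?_ (by simp [Prog.cost]; omega)⟩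
  · simp [ht, hin.reg1]; have := hin.succ_le; omega
  simp only [Prog.wp, Mem.setReg_reg, Mem.setReg_arr, ht, hin.reg1]
  norm_num
  rw [hin.off_succ t htn]
  refine ⟨hoff, ?_⟩
  have key := Runs.scan (B := B) (ri := 9) (rk := 10) (x := 11) (a := 1) (body := body)
    (s₀ := ((s₀.setReg 9 (s₀.arr 0 t)).setReg 10 (t + 1)).setReg 10
      (s₀.arr 0 t + (adj t).length)) (i₀ := s₀.arr 0 t) (L := adj t) I (fun _ => c)
    (by simp) (by simp) hoff (by simp [hin.reg1])
    (fun v hv => by have := hA.lt hv; have := hin.succ_le; omega)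
    (hin.stores t htn) (by decide) (by decide) (by decide) (by decide) (by decide) w9 w10 w1
    (hI _ _ _ (hI _ _ _ (hI _ _ _ h₀).1).2.1).2.1
    (fun l s k h => ⟨(hI l s k h).1, (hI l s k h).2.2⟩)
    (fun l s hf _ i _ => by rw [hf.arr 1 (by simpa [Prog.scan, Prog.range, Prog.writesArr] using wa)])
    (fun l v l' s hl hf hIs hv => step l v l' s hl ⟨fun y hy => ?_, fun y hy => ?_⟩ hIs hv)
  · refine key.mono ?_ (fun _ _ h => h)
    simp
  · simp only [WordRAM.scanAdj, Prog.writesReg, Bool.or_eq_false_iff, beq_eq_false_iff_ne] at hy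
    rw [hf.reg y hy.2.2.2]
    simp [hy]
  · simp only [WordRAM.scanAdj, Prog.writesArr, Bool.false_or] at hy
    rw [hf.arr y hy]
    simp

/-- The cost `f` of the body depends on the vertex, because the body scans its adjacency list. The
total is then a sum of degrees rather than a product with a maximum. -/
theorem Runs.scanQueue {body : Prog} {s₀ : Mem} {Q : List ℕ} {a : ℕ} (ha : s₀.reg 3 = a)
    (hb : s₀.reg 4 = Q.length) (haQ : a ≤ Q.length) (hQB : Q.length ≤ B) (h1 : s₀.reg 1 = 1)
    (hQ : Stores (s₀.arr 4) 0 Q) (hQn : ∀ v ∈ Q, v ≤ B)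
    (I : List ℕ → Mem → Prop) (f : ℕ → ℕ)
    (w1 : body.writesReg 1 = false) (w7 : body.writesReg 7 = false)
    (w4 : body.writesReg 4 = false) (h₀ : I [] s₀)
    (hI : ∀ l s k, I l s → I l (s.setReg 7 k) ∧ I l (s.setReg 8 k))
    (hstab : ∀ l s, Frame (scanQueue body) s₀ s → I l s →
      ∀ i < Q.length, s.arr 4 i = s₀.arr 4 i)
    (step : ∀ l v l' s, Q.drop a = l ++ v :: l' → Frame (scanQueue body) s₀ s → I l s →
      s.reg 8 = v → Runs B body s (f v) (I (l ++ [v]))) :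
    Runs B (scanQueue body) s₀ (((Q.drop a).map fun v => f v + 3).sum + 2) (I (Q.drop a)) := by
  unfold WordRAM.scanQueue
  refine Runs.wp_seq (p := .move 7 3) (T := ((Q.drop a).map fun v => f v + 3).sum + 1) ?_
    (by simp [Prog.cost]; omega)
  refine ⟨by omega, ?_⟩
  rw [ha]
  have hfr : ∀ s, Frame (.scan 7 4 8 4 body) (s₀.setReg 7 a) s →
      Frame (WordRAM.scanQueue body) s₀ s := by
    intro s hf
    refine ⟨fun y hy => ?_, fun y hy => ?_⟩
    · simp only [WordRAM.scanQueue, Prog.writesReg, Bool.or_eq_false_iff,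
        beq_eq_false_iff_ne] at hy
      rw [hf.reg y hy.2]
      simp [hy]
    · simp only [WordRAM.scanQueue, Prog.writesArr, Bool.false_or] at hy
      rw [hf.arr y hy]
      simp
  refine Runs.scan (B := B) (ri := 7) (rk := 4) (x := 8) (a := 4) (body := body)
    (i₀ := a) (L := Q.drop a) I f
    (by simp) (by simp; omega) (by simp; omega) (by simp [h1])
    (fun v hv => hQn v (List.mem_of_mem_drop hv))
    (hQ.drop a) (by decide) (by decide) (by decide) (by decide) (by decide) w7 w4 w1
    (hI _ _ _ h₀).1 (fun l s k h => hI l s k h)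
    (fun l s hf hIs i hi => ?_)
    (fun l v l' s hl hf hIs hv => step l v l' s hl (hfr s hf) hIs hv)
  rw [List.length_drop] at hi
  rw [hstab l s (hfr s hf) hIs (a + i) (by omega)]
  rfl

theorem Runs.scanTouched {body : Prog} {s₀ : Mem} {U : List ℕ}
    (hb : s₀.reg 6 = U.length) (hUB : U.length ≤ B) (h1 : s₀.reg 1 = 1)
    (hU : Stores (s₀.arr 5) 0 U) (hUn : ∀ v ∈ U, v ≤ B)
    (I : List ℕ → Mem → Prop) (c : ℕ)
    (w1 : body.writesReg 1 = false) (w7 : body.writesReg 7 = false)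
    (w6 : body.writesReg 6 = false) (w5 : body.writesArr 5 = false) (h₀ : I [] s₀)
    (hI : ∀ l s k, I l s → I l (s.setReg 7 k) ∧ I l (s.setReg 11 k))
    (step : ∀ l v l' s, U = l ++ v :: l' → Frame (scanTouched body) s₀ s → I l s →
      s.reg 11 = v → Runs B body s c (I (l ++ [v]))) :
    Runs B (scanTouched body) s₀ (U.length * (c + 3) + 2) (I U) := by
  unfold WordRAM.scanTouched
  refine Runs.wp_seq (p := .const 7 0) (T := U.length * (c + 3) + 1) ?_
    (by simp [Prog.cost]; omega)
  refine ⟨by omega, ?_⟩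
  have hfr : ∀ s, Frame (.scan 7 6 11 5 body) (s₀.setReg 7 0) s →
      Frame (WordRAM.scanTouched body) s₀ s := by
    intro s hf
    refine ⟨fun y hy => ?_, fun y hy => ?_⟩
    · simp only [WordRAM.scanTouched, Prog.writesReg, Bool.or_eq_false_iff,
        beq_eq_false_iff_ne] at hy
      rw [hf.reg y hy.2]
      simp [hy]
    · simp only [WordRAM.scanTouched, Prog.writesArr, Bool.false_or] at hy
      rw [hf.arr y hy]
      simp
  refine (Runs.scan (B := B) (ri := 7) (rk := 6) (x := 11) (a := 5) (body := body)
    (s₀ := s₀.setReg 7 0) (i₀ := 0) (L := U) I (fun _ => c)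
    (by simp) (by simp [hb]) (by simpa using hUB) (by simp [h1]) hUn
    hU (by decide) (by decide) (by decide) (by decide) (by decide) w7 w6 w1
    (hI _ _ _ h₀).1 (fun l s k h => hI l s k h)
    (fun l s hf hIs i hi => ?_)
    (fun l v l' s hl hf hIs hv => step l v l' s hl (hfr s hf) hIs hv)).mono (by simp)
    (fun _ _ h => h)
  rw [(hfr s hf).arr 5 (by simpa [WordRAM.scanTouched, Prog.scan, Prog.range, Prog.writesArr]
    using w5)]
  rfl

/-! ### Effect and running time of one round -/

/-- The effect of counting the edges whose ends are listed in `P`, starting from memory `s₀`; the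
sources of the edges belong to `T`. -/
structure Touched (adj : ℕ → List ℕ) (T : List ℕ) (s₀ : Mem) (P : List ℕ) (s : Mem) : Prop where
  cnt : ∀ v, s.arr 6 v = if s₀.arr 3 v = 1 then P.count v else 0
  list : ∃ U : List ℕ, s.reg 6 = U.length ∧ Stores (s.arr 5) 0 U ∧ U.Nodup ∧
    (∀ v, v ∈ U ↔ s₀.arr 3 v = 1 ∧ v ∈ P) ∧ U.length ≤ P.length
  par_old : ∀ v, ¬ (s₀.arr 7 v = 0 ∧ s₀.arr 3 v = 1 ∧ v ∈ P) → s.arr 7 v = s₀.arr 7 v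
  par_new : ∀ v, s₀.arr 7 v = 0 → s₀.arr 3 v = 1 → v ∈ P →
    ∃ t ∈ T, v ∈ adj t ∧ s.arr 7 v = t + 1

theorem Touched.setReg {T P : List ℕ} {s₀ s : Mem} (h : Touched adj T s₀ P s) {x : ℕ} (k : ℕ)
    (hx : x ≠ 6) : Touched adj T s₀ P (s.setReg x k) := by
  obtain ⟨a, b, c, d⟩ := h
  exact ⟨a, by simpa [hx.symm] using b, c, d⟩

/-- There are three cases. A neighbour inside the queue is ignored. One touched before only has its
counter raised. At the first touch in the round the vertex also enters the list, and it gets a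
parent if its entry is still zero; thus a parent assigned in an earlier round is kept. -/
theorem touchBody_runs {s₀ s : Mem} {T P : List ℕ} {t v : ℕ} (h : Touched adj T s₀ P s)
    (h3 : s.arr 3 = s₀.arr 3) (h1 : s.reg 1 = 1) (h2 : s.reg 2 = 0) (h8 : s.reg 8 = t)
    (h11 : s.reg 11 = v) (htT : t ∈ T) (hv : v ∈ adj t) (htB : t + 1 ≤ B) (hvB : v ≤ B)
    (hPB : P.length + 1 ≤ B) (h3B : s.arr 3 v ≤ B) (h7B : s.arr 7 v ≤ B) :
    Runs B touchBody s 13 (Touched adj T s₀ (P ++ [v])) := by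
  refine (Runs.of_wp (p := touchBody) ?_).mono (by simp [touchBody, Prog.cost]) (fun _ _ h => h)
  obtain ⟨U, hU1, hU2, hU3, hU4, hU5⟩ := h.list
  have hcnt := h.cnt v
  have hc : P.count v ≤ P.length := List.count_le_length
  by_cases hS : s₀.arr 3 v = 1
  swap
  · have : Touched adj T s₀ (P ++ [v]) (s.setReg 12 (s.arr 3 v)) := by
      refine (Touched.setReg ?_ _ (by decide))
      have key : ∀ w, s₀.arr 3 w = 1 → (w ∈ P ++ [v] ↔ w ∈ P) := by
        intro w hw
        have : w ≠ v := by rintro rfl; exact hS hw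
        simp [this]
      refine ⟨fun w => ?_, ⟨U, hU1, hU2, hU3, fun w => ?_, by simp; omega⟩, fun w hw => ?_,
        fun w h0 hw hwP => h.par_new w h0 hw ((key w hw).1 hwP)⟩
      · rw [h.cnt]
        split_ifs with hw
        · have : v ≠ w := by rintro rfl; exact hS hw
          rw [List.count_append, List.count_singleton]
          simp [this]
        · rfl
      · rw [hU4]
        exact and_congr_right fun hw => (key w hw).symm
      · exact h.par_old w fun ⟨x, y, z⟩ => hw ⟨x, y, (key w y).2 z⟩
    simpa [touchBody, Prog.wp, Test.Holds, h11, h1, h3, hS, h3B, h3 ▸ h3B] using this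
  rw [if_pos hS] at hcnt
  have hvU : v ∈ U ↔ v ∈ P := by rw [hU4]; exact and_iff_right hS
  have hmem : ∀ w, w ∈ P ++ [v] ↔ w ∈ P ∨ w = v := by simp
  -- the counters
  have cnt' : ∀ w, Function.update (s.arr 6) v (s.arr 6 v + 1) w =
      if s₀.arr 3 w = 1 then (P ++ [v]).count w else 0 := by
    intro w
    rw [Function.update_apply, List.count_append, List.count_singleton]
    by_cases hw : w = v
    · subst hw
      simp [hcnt, hS]
    · simp [hw, Ne.symm hw, h.cnt]
  by_cases hP : v ∈ P
  · have hne : P.count v ≠ 0 := by simpa [List.count_eq_zero] using hP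
    have hmem' : ∀ w, w ∈ P ++ [v] ↔ w ∈ P := by
      intro w; rw [hmem]; constructor
      · rintro (h | rfl) <;> assumption
      · exact Or.inl
    have : Touched adj T s₀ (P ++ [v])
        (((((s.setReg 12 1).setReg 12 (P.count v))).setReg 12
          (P.count v + 1)).setArr 6 v (P.count v + 1)) := by
      refine ⟨fun w => ?_, ⟨U, ?_, ?_, hU3, fun w => by rw [hU4, hmem'], by simp; omega⟩,
        fun w hw => ?_, fun w h0 hw hwP => ?_⟩
      · simpa [hcnt] using cnt' w
      · simpa using hU1
      · simpa using hU2
      · simpa using h.par_old w (by rwa [hmem'] at hw)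
      · simpa using h.par_new w h0 hw ((hmem' w).1 hwP)
    simp [touchBody, Prog.wp, Test.Holds, h11, h1, h2, h3, hS, hcnt, hne, hvB]
    refine ⟨by omega, by omega, by omega, this⟩
  · have hne : P.count v = 0 := List.count_eq_zero.2 hP
    have hvU' : v ∉ U := fun h => hP (hvU.1 h)
    rw [hne] at hcnt
    have hpar : s.arr 7 v = s₀.arr 7 v := h.par_old v fun h => hP h.2.2
    have hS5 := hU2.snoc v
    rw [zero_add] at hS5
    have nd : (U ++ [v]).Nodup := by
      rw [List.nodup_append]
      refine ⟨hU3, List.nodup_singleton _, fun a ha b hb => ?_⟩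
      rw [List.mem_singleton] at hb
      rintro rfl
      exact hvU' (hb ▸ ha)
    have hU4' : ∀ w, w ∈ U ++ [v] ↔ s₀.arr 3 w = 1 ∧ w ∈ P ++ [v] := by
      intro w
      rw [hmem, List.mem_append, hU4, List.mem_singleton]
      constructor
      · rintro (h | rfl)
        · exact ⟨h.1, Or.inl h.2⟩
        · exact ⟨hS, Or.inr rfl⟩
      · rintro ⟨h, h' | h'⟩
        · exact Or.inl ⟨h, h'⟩
        · exact Or.inr h'
    by_cases hp : s₀.arr 7 v = 0
    · simp [touchBody, Prog.wp, Test.Holds, h11, h1, h2, h3, hS, hcnt, hvB, hpar, hp, h8, hU1]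
      refine ⟨by omega, by omega, htB, by omega, ?_⟩
      refine ⟨fun w => ?_, ⟨U ++ [v], ?_, ?_, nd, hU4', by simp; omega⟩,
        fun w hw => ?_, fun w h0 hw hwP => ?_⟩
      · simpa [hcnt] using cnt' w
      · simp
      · simpa using hS5
      · have hwv : w ≠ v := by
          rintro rfl
          exact hw ⟨hp, hS, by simp⟩
        simpa [Function.update_apply, hwv] using h.par_old w fun ⟨x, y, z⟩ =>
          hw ⟨x, y, (hmem w).2 (Or.inl z)⟩
      · by_cases hwv : w = v
        · subst hwv
          exact ⟨t, htT, hv, by simp⟩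
        · simpa [Function.update_apply, hwv] using
            h.par_new w h0 hw (((hmem w).1 hwP).resolve_right hwv)
    · rw [hpar] at h7B
      simp [touchBody, Prog.wp, Test.Holds, h11, h1, h2, h3, hS, hcnt, hvB, hpar, hp, h8, hU1]
      refine ⟨by omega, by omega, h7B, by omega, ?_⟩
      refine ⟨fun w => ?_, ⟨U ++ [v], ?_, ?_, nd, hU4', by simp; omega⟩,
        fun w hw => ?_, fun w h0 hw hwP => ?_⟩
      · simpa [hcnt] using cnt' w
      · simp
      · simpa using hS5
      · simpa using h.par_old w fun ⟨x, y, z⟩ => hw ⟨x, y, (hmem w).2 (Or.inl z)⟩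
      · have hwv : w ≠ v := by
          rintro rfl
          exact hp h0
        simpa using h.par_new w h0 hw (((hmem w).1 hwP).resolve_right hwv)

/-- The refinement loop has the queue `Q`, whose first `a` elements have been processed. -/
structure AtQueue (n : ℕ) (Q : List ℕ) (a : ℕ) (s : Mem) : Prop where
  reg3 : s.reg 3 = a
  reg4 : s.reg 4 = Q.length
  reg5 : s.reg 5 = Q.length
  le : a ≤ Q.length
  nodup : Q.Nodup
  lt : ∀ v ∈ Q, v < n
  stores : Stores (s.arr 4) 0 Q
  flag : ∀ v, s.arr 3 v = if v < n ∧ v ∉ Q then 1 else 0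
  cnt : ∀ v, s.arr 6 v = 0
  par : ∀ v, s.arr 7 v ≤ n

theorem length_le_of_nodup {Q : List ℕ} (h : Q.Nodup) (hlt : ∀ v ∈ Q, v < n) :
    Q.length ≤ n := by
  have := (List.subperm_of_subset h (l₂ := List.range n) fun v hv => List.mem_range.2 (hlt v hv))
  simpa using this.length_le

theorem mem_of_nodup_length {Q : List ℕ} (h : Q.Nodup) (hlt : ∀ v ∈ Q, v < n)
    (hn : n ≤ Q.length) {v : ℕ} (hv : v < n) : v ∈ Q := by
  have := (List.subperm_of_subset h (l₂ := List.range n) fun v hv => List.mem_range.2 (hlt v hv))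
  exact (this.perm_of_length_le (by simpa using hn)).mem_iff.2 (List.mem_range.2 hv)

theorem AtQueue.flag_iff {Q : List ℕ} {a : ℕ} {s : Mem} (h : AtQueue n Q a s) (v : ℕ) :
    s.arr 3 v = 1 ↔ v < n ∧ v ∉ Q := by
  rw [h.flag]
  split_ifs with h <;> simp [h]

/-- The sum of the lengths of the lists of the vertices in `l`. -/
abbrev volume (adj : ℕ → List ℕ) (l : List ℕ) : ℕ := (l.flatMap adj).length

theorem touch_runs {s₀ : Mem} {Q : List ℕ} {a : ℕ} (hA : AdjLists n adj)
    (hin : HasInput B n adj s₀) (hQ : AtQueue n Q a s₀)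
    (hB : volume adj (Q.drop a) + 1 ≤ B) :
    Runs B touch s₀ (((Q.drop a).map fun t => ((adj t).length * 16 + 7)).sum + 3)
      (Touched adj (Q.drop a) s₀ ((Q.drop a).flatMap adj)) := by
  unfold touch
  refine Runs.wp_seq (p := .const 6 0)
    (T := ((Q.drop a).map fun t => ((adj t).length * 16 + 7)).sum + 2) ?_
    (by simp [Prog.cost]; omega)
  have hQn := length_le_of_nodup hQ.nodup hQ.lt
  have hBn := hin.succ_le
  refine ⟨by omega, ?_⟩
  refine Runs.scanQueue (B := B) (s₀ := s₀.setReg 6 0) (body := scanAdj touchBody) (Q := Q) (a := a) hQ.reg3 hQ.reg4 hQ.le (by omega) hin.reg1 hQ.stores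
    (fun v hv => by have := hQ.lt v hv; omega)
    (fun l s => Touched adj (Q.drop a) s₀ (l.flatMap adj) s) (fun t => (adj t).length * 16 + 4)
    rfl rfl rfl ?_ (fun l s k h => ⟨h.setReg _ (by decide), h.setReg _ (by decide)⟩)
    (fun l s hf _ i _ => by rw [hf.arr 4 rfl]) ?_
  · exact ⟨by simpa using hQ.cnt, ⟨[], by simp [Stores.nil]⟩, by simp, by simp⟩
  · intro l t l' s hl hf hs h8
    have htT : t ∈ Q.drop a := by rw [hl]; simp
    have htn : t < n := hQ.lt t (List.mem_of_mem_drop htT)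
    have hin' : HasInput B n adj s :=
      (hin.frame (p := touch) (s' := s₀.setReg 6 0) ⟨by
        intro x hx
        have : x ≠ 6 := by rintro rfl; revert hx; decide
        simp [this], fun _ _ => rfl⟩ rfl rfl rfl rfl rfl).frame hf rfl rfl rfl rfl rfl
    refine Runs.mono (Runs.scanAdj (body := touchBody) hA hin' h8 htn
      (fun m s => Touched adj (Q.drop a) s₀ (l.flatMap adj ++ m) s) 13 rfl rfl rfl rfl
      (by simpa using hs)
      (fun l s k h => ⟨h.setReg _ (by decide), h.setReg _ (by decide), h.setReg _ (by decide)⟩)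
      ?_) le_rfl (fun s' _ h => by simpa using h)
    intro m v m' s' hm hf' hs' h11
    have hv : v ∈ adj t := by rw [hm]; simp
    have h3 : s'.arr 3 = s₀.arr 3 := (hf'.arr 3 rfl).trans (hf.arr 3 rfl)
    have hlen : (l.flatMap adj ++ m).length + 1 ≤ B := by
      refine le_trans ?_ hB
      rw [volume, hl]
      simp [hm]
    have := touchBody_runs (B := B) (t := t) (v := v) hs' h3
      ((hf'.reg 1 rfl).trans hin'.reg1) ((hf'.reg 2 rfl).trans hin'.reg2)
      ((hf'.reg 8 rfl).trans h8) h11 htT hv (by omega) (by have := hA.lt hv; omega) hlen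
      (by rw [h3, hQ.flag]; split_ifs <;> omega) ?_
    · simpa [List.append_assoc] using this
    -- A parent entry written in this round is `t' + 1` with `t' < n`, and any other one is bounded
    -- by the invariant, so the word bound holds.
    · by_cases hc : s₀.arr 7 v = 0 ∧ s₀.arr 3 v = 1 ∧ v ∈ l.flatMap adj ++ m
      · obtain ⟨t', ht', -, e⟩ := hs'.par_new v hc.1 hc.2.1 hc.2.2
        have := hQ.lt t' (List.mem_of_mem_drop ht')
        omega
      · rw [hs'.par_old v hc]
        have := hQ.par v
        omega

theorem sum_map_length (adj : ℕ → List ℕ) (c d : ℕ) (l : List ℕ) :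
    (l.map fun t => (adj t).length * c + d).sum = volume adj l * c + l.length * d := by
  induction l with
  | nil => simp [volume]
  | cons t l ih =>
    simp only [List.map_cons, List.sum_cons, ih, volume, List.flatMap_cons, List.length_append,
      List.length_cons]
    ring

/-- Register `13` holds a vertex `y` outside the queue with a minimal number of neighbours in `T`, or
the number `n` if such a vertex `y` has no neighbours in `T`. -/
def Chosen (n : ℕ) (adj : ℕ → List ℕ) (Q T : List ℕ) (y b : ℕ) : Prop :=
  y < n ∧ y ∉ Q ∧ b ≤ n ∧ (∀ t ∈ T, b ∈ adj t ↔ y ∈ adj t) ∧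
    ((∀ t ∈ T, y ∉ adj t) ∨ ((∀ v < n, v ∉ Q → ∃ t ∈ T, v ∈ adj t) ∧
      ∀ v < n, v ∉ Q → (T.flatMap adj).count y ≤ (T.flatMap adj).count v))

/-- Only touched vertices are inspected, so the time is bounded by the number of edges counted, not
by the number of vertices outside the queue. -/
theorem choose_runs {s₀ s : Mem} {Q : List ℕ} {a : ℕ} (hA : AdjLists n adj)
    (hin : HasInput B n adj s) (hQ : AtQueue n Q a s₀) (hex : ∃ v < n, v ∉ Q)
    (hf : Frame touch s₀ s) (hB : volume adj (Q.drop a) + 1 ≤ B)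
    (hT : Touched adj (Q.drop a) s₀ ((Q.drop a).flatMap adj) s) :
    Runs B choose s (volume adj (Q.drop a) * 7 + 6) fun s' =>
      ∃ y, Chosen n adj Q (Q.drop a) y (s'.reg 13) := by
  obtain ⟨U, hU1, hU2, hU3, hU4, hU5⟩ := hT.list
  have hUn : ∀ v ∈ U, v < n := fun v hv => ((hQ.flag_iff v).1 ((hU4 v).1 hv).1).1
  -- Touched vertices lie outside the queue, so `|U| + |Q| ≤ n`, with equality exactly if every
  -- vertex outside the queue is touched. This is the test of the program.
  have hUQ : (U ++ Q).Nodup := by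
    refine List.nodup_append.2 ⟨hU3, hQ.nodup, ?_⟩
    rintro v hv w hw rfl
    exact ((hQ.flag_iff v).1 ((hU4 v).1 hv).1).2 hw
  have hUQn : ∀ v ∈ U ++ Q, v < n := by
    intro v hv
    rcases List.mem_append.1 hv with h | h
    exacts [hUn v h, hQ.lt v h]
  have hlen := length_le_of_nodup hUQ hUQn
  rw [List.length_append] at hlen
  have hBn := hin.succ_le
  have h4 : s.reg 4 = Q.length := (hf.reg 4 rfl).trans hQ.reg4
  have htouch : ∀ v, v ∈ U ↔ (v < n ∧ v ∉ Q) ∧ ∃ t ∈ Q.drop a, v ∈ adj t := by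
    intro v
    rw [hU4, hQ.flag_iff, List.mem_flatMap]
  have hcle : ∀ v, s.arr 6 v ≤ volume adj (Q.drop a) := by
    intro v
    rw [hT.cnt]
    split_ifs
    · exact List.count_le_length
    · omega
  change U.length ≤ volume adj (Q.drop a) at hU5
  generalize volume adj (Q.drop a) = V at hB hcle hU5 ⊢
  unfold choose
  refine Runs.wp_seq (p := .add 16 6 4) (T := V * 7 + 5) ?_
    (by simp [Prog.cost]; omega)
  refine ⟨by omega, ?_⟩
  rw [hU1, h4]
  refine Runs.ite (T := V * 7 + 4) (fun hb => ?_) (fun hb => ?_)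
  · have hb' : U.length + Q.length = n := by simpa [Test.Holds, hin.reg0] using hb
    have hall : ∀ v < n, v ∉ Q → v ∈ U := by
      intro v hv hvQ
      have := mem_of_nodup_length hUQ hUQn (by rw [List.length_append]; omega) hv
      exact (List.mem_append.1 this).resolve_right hvQ
    obtain ⟨v₀, hv₀, hv₀Q⟩ := hex
    have hpos : 0 < U.length := List.length_pos_of_mem (hall v₀ hv₀ hv₀Q)
    have hU0 : s.arr 5 0 = U[0] := by simpa using hU2 0 hpos
    refine Runs.wp_seq (p := .load 13 5 2) (T := V * 7 + 3) ?_
      (by simp [Prog.cost]; omega)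
    have hU0n := hUn U[0] (List.getElem_mem _)
    refine ⟨by simp [hin.reg2, hU0]; omega, Runs.wp_seq (p := .load 14 6 13)
      (T := V * 7 + 2) ?_ (by simp [Prog.cost]; omega)⟩
    simp only [Prog.wp, Mem.setReg_reg, Mem.setReg_arr]
    norm_num
    rw [hin.reg2, hU0]
    have hc0 := hcle U[0]
    refine ⟨by omega, ?_⟩
    have key := Runs.scanTouched (B := B) (U := U)
      (body := .seq (.load 12 6 11) <| .ite (.lt 12 14) (.seq (.move 13 11) (.move 14 12)) .skip)
      (s₀ := (((s.setReg 16 (U.length + Q.length)).setReg 13 U[0]).setReg 14 (s.arr 6 U[0])))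
      (by simpa using hU1) (by omega) (by simpa using hin.reg1) hU2
      (fun v hv => by have := hUn v hv; omega)
      (fun l s' => s'.reg 13 ∈ U ∧ s'.reg 14 = s.arr 6 (s'.reg 13) ∧
        ∀ w ∈ l, s'.reg 14 ≤ s.arr 6 w) 4 rfl rfl rfl rfl (by simp) (by simp) ?_
    · refine key.mono (by omega) ?_
      rintro s' - ⟨h1, h2, h3⟩
      have hy := (htouch _).1 h1
      refine ⟨s'.reg 13, hy.1.1, hy.1.2, hy.1.1.le, fun _ _ => Iff.rfl, Or.inr
        ⟨fun v hv hvQ => ((htouch v).1 (hall v hv hvQ)).2, fun v hv hvQ => ?_⟩⟩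
      have := h3 v (hall v hv hvQ)
      rwa [h2, hT.cnt, hT.cnt, if_pos ((hQ.flag_iff _).2 hy.1),
        if_pos ((hQ.flag_iff _).2 ⟨hv, hvQ⟩)] at this
    · rintro l v l' s' hl hf' ⟨h1, h2, h3⟩ hv
      have h6 : s'.arr 6 = s.arr 6 := hf'.arr 6 rfl
      have hvU : v ∈ U := by rw [hl]; simp
      have hvn := hUn v hvU
      have hcv := hcle v
      refine Runs.of_wp (p := .seq (.load 12 6 11) <|
        .ite (.lt 12 14) (.seq (.move 13 11) (.move 14 12)) .skip) ?_
      by_cases hlt : s.arr 6 v < s'.reg 14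
      · simp [Prog.wp, Test.Holds, hv, h6, hlt, hvU]
        refine ⟨by omega, by omega, by omega, ?_⟩
        rintro w (hw | rfl)
        · exact (hlt.trans_le (h3 w hw)).le
        · exact le_rfl
      · simp [Prog.wp, Test.Holds, hv, h6, hlt]
        refine ⟨by omega, h1, h2, ?_⟩
        rintro w (hw | rfl)
        · exact h3 w hw
        · omega
  · have hb' : U.length + Q.length ≠ n := by simpa [Test.Holds, hin.reg0] using hb
    have hy : ∃ y < n, y ∉ Q ∧ y ∉ U := by
      by_contra! hcon
      refine hb' (le_antisymm hlen ?_)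
      have := (List.subperm_of_subset (List.nodup_range (n := n)) (l₂ := U ++ Q) fun v hv => by
        by_cases hvQ : v ∈ Q
        · exact List.mem_append_right _ hvQ
        · exact List.mem_append_left _ (hcon v (List.mem_range.1 hv) hvQ))
      simpa using this.length_le
    obtain ⟨y, hyn, hyQ, hyU⟩ := hy
    have hyT : ∀ t ∈ Q.drop a, y ∉ adj t := fun t ht hyt =>
      hyU ((htouch y).2 ⟨⟨hyn, hyQ⟩, t, ht, hyt⟩)
    -- An untouched vertex need not be found. It has no neighbour in `T`, and neither has the number
    -- `n`, which occurs in no adjacency list and can replace it.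
    refine (Runs.of_wp (p := .move 13 0) ⟨?_, y, hyn, hyQ, ?_, ?_, Or.inl hyT⟩).mono
      (by simp [Prog.cost]) (fun _ _ h => h)
    · simp [hin.reg0]; omega
    · simp [hin.reg0]
    · intro t ht
      simp only [Mem.setReg_reg, hin.reg0]
      norm_num
      exact ⟨fun h => absurd (hA.lt h) (lt_irrefl _), fun h => absurd h (hyT t ht)⟩

/-- Only touched vertices can have a nonzero counter, so clearing the list `U` clears all counters
within the budget of the round. -/
theorem resetCounters_runs {s : Mem} {U : List ℕ} (hin : HasInput B n adj s)
    (hU1 : s.reg 6 = U.length) (hU2 : Stores (s.arr 5) 0 U) (hU3 : U.Nodup)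
    (hUn : ∀ v ∈ U, v < n) (hU : ∀ v, s.arr 6 v ≠ 0 → v ∈ U) :
    Runs B resetCounters s (U.length * 4 + 2) fun s' => ∀ v, s'.arr 6 v = 0 := by
  have hlen := length_le_of_nodup hU3 hUn
  have hBn := hin.succ_le
  refine (Runs.scanTouched (B := B) (U := U) (body := .store 6 11 2) hU1 (by omega) hin.reg1 hU2
    (fun v hv => by have := hUn v hv; omega)
    (fun l s' => ∀ v, s'.arr 6 v = if v ∈ l then 0 else s.arr 6 v) 1 rfl rfl rfl rfl
    (by simp) (by simp) ?_).mono le_rfl ?_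
  · intro l v l' s' hl hf hs' hv
    have h2 : s'.reg 2 = 0 := (hf.reg 2 rfl).trans hin.reg2
    refine Runs.of_wp (p := .store 6 11 2) ⟨by omega, fun w => ?_⟩
    rw [hv, h2, Mem.setArr_arr, if_pos rfl, Function.update_apply, hs']
    by_cases h1 : w = v <;> simp [h1]
  · intro s' hf hs' v
    rw [hs']
    split_ifs with h
    · rfl
    · by_contra hne
      exact h (hU v hne)

/-- The queue `Q` was prolonged by the vertices that satisfy `C`. -/
def Expelled (n : ℕ) (Q : List ℕ) (C : ℕ → Prop) (s : Mem) : Prop :=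
  ∃ N : List ℕ, s.reg 5 = (Q ++ N).length ∧ Stores (s.arr 4) 0 (Q ++ N) ∧ (Q ++ N).Nodup ∧
    (∀ v, s.arr 3 v = if v < n ∧ v ∉ Q ++ N then 1 else 0) ∧
    ∀ v, v ∈ N ↔ v < n ∧ v ∉ Q ∧ C v

theorem Expelled.congr {Q : List ℕ} {C C' : ℕ → Prop} {s s' : Mem} (h : Expelled n Q C s)
    (hC : ∀ v, C v ↔ C' v) (h5 : s'.reg 5 = s.reg 5) (h4 : s'.arr 4 = s.arr 4)
    (h3 : s'.arr 3 = s.arr 3) : Expelled n Q C' s' := by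
  obtain rfl : C = C' := funext fun v => propext (hC v)
  simpa only [Expelled, h5, h4, h3] using h

theorem expelBody_runs {Q : List ℕ} {C : ℕ → Prop} {s : Mem} {v : ℕ} (h : Expelled n Q C s)
    (hQ : ∀ v ∈ Q, v < n) (h1 : s.reg 1 = 1) (h2 : s.reg 2 = 0) (hv : s.reg 11 = v) (hvn : v < n)
    (hB : n + 1 ≤ B) :
    Runs B expelBody s 5 (Expelled n Q fun w => C w ∨ w = v) := by
  obtain ⟨N, hN1, hN2, hN3, hN4, hN5⟩ := h
  refine (Runs.of_wp (p := expelBody) ?_).mono (by simp [expelBody, Prog.cost]) (fun _ _ h => h)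
  by_cases hvN : v ∈ Q ++ N
  · have h3 : s.arr 3 v = 0 := by rw [hN4, if_neg (by tauto)]
    simp [expelBody, Prog.wp, Test.Holds, hv, h1, h3]
    refine ⟨N, hN1, hN2, hN3, hN4, fun w => ?_⟩
    rw [hN5]
    refine ⟨fun h => ⟨h.1, h.2.1, Or.inl h.2.2⟩, fun ⟨h, h', h''⟩ => ⟨h, h', ?_⟩⟩
    rcases h'' with h'' | rfl
    · exact h''
    · exact ((hN5 w).1 ((List.mem_append.1 hvN).resolve_left h')).2.2
  · have h3 : s.arr 3 v = 1 := by rw [hN4, if_pos ⟨hvn, hvN⟩]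
    have hnd : (Q ++ N ++ [v]).Nodup := by
      refine List.nodup_append.2 ⟨hN3, List.nodup_singleton _, ?_⟩
      rintro a ha b hb rfl
      rw [List.mem_singleton] at hb
      exact hvN (hb ▸ ha)
    have hlen := length_le_of_nodup (n := n) hnd fun w hw => by
      rcases List.mem_append.1 hw with hw | hw
      · rcases List.mem_append.1 hw with hw | hw
        exacts [hQ w hw, ((hN5 w).1 hw).1]
      · rw [List.mem_singleton] at hw
        omega
    rw [List.length_append, List.length_singleton] at hlen
    have hst := hN2.snoc v
    rw [zero_add, List.append_assoc] at hst
    rw [List.append_assoc] at hnd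
    simp only [expelBody, Prog.wp, Test.Holds, Mem.setReg_reg, hv, h1, h3, Mem.setArr_reg, h2, hN1]
    norm_num
    simp only [List.length_append] at hlen
    refine ⟨by omega, by omega, by omega, N ++ [v], ?_, ?_, hnd, fun w => ?_, fun w => ?_⟩
    · simp; omega
    · simpa using hst
    · simp only [Mem.setReg_arr, Mem.setArr_arr]
      norm_num
      rw [Function.update_apply, hN4]
      by_cases hwv : w = v
      · simp [hwv]
      · simp [hwv]
    · rw [List.mem_append, hN5, List.mem_singleton]
      rw [List.mem_append, not_or] at hvN
      constructor
      · rintro (h | rfl)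
        · exact ⟨h.1, h.2.1, Or.inl h.2.2⟩
        · exact ⟨hvn, hvN.1, Or.inr rfl⟩
      · rintro ⟨h, h', h'' | h''⟩
        · exact Or.inl ⟨h, h', h''⟩
        · exact Or.inr h''

/-- Each list is scanned at most twice: first to see whether it contains the chosen vertex, and, if
not, to append those of its entries that are not in the queue. -/
theorem expel_runs {s : Mem} {Q : List ℕ} {a b : ℕ} (hA : AdjLists n adj)
    (hin : HasInput B n adj s) (h3 : s.reg 3 = a) (h4 : s.reg 4 = Q.length) (ha : a ≤ Q.length)
    (hQ : ∀ v ∈ Q, v < n) (hQ4 : Stores (s.arr 4) 0 Q) (hb : s.reg 13 = b)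
    (hE : Expelled n Q (fun _ => False) s) :
    Runs B expel s (volume adj (Q.drop a) * 13 + (Q.drop a).length * 13 + 2)
      (Expelled n Q fun v => ∃ t ∈ Q.drop a, v ∈ adj t ∧ b ∉ adj t) := by
  have hBn := hin.succ_le
  have hQn : Q.length ≤ n := by
    obtain ⟨N, -, -, h, -, -⟩ := hE
    exact length_le_of_nodup (List.nodup_append.1 h).1 hQ
  have key := Runs.scanQueue (B := B) (s₀ := s) (Q := Q) (a := a)
    (body := .seq (.const 15 0) <| .seq (scanAdj (.ite (.eq 11 13) (.move 15 1) .skip)) <|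
      .ite (.eq 15 2) (scanAdj expelBody) .skip) h3 h4 ha (by omega) hin.reg1 hQ4
    (fun v hv => by have := hQ v hv; omega)
    (fun l => Expelled n Q fun v => ∃ t ∈ l, v ∈ adj t ∧ b ∉ adj t)
    (fun t => (adj t).length * 13 + 10) rfl rfl rfl (hE.congr (by simp) rfl rfl rfl)
    (fun l s k h => ⟨h.congr (fun _ => Iff.rfl) rfl rfl rfl,
      h.congr (fun _ => Iff.rfl) rfl rfl rfl⟩) ?_ ?_
  · refine key.mono (le_of_eq ?_) (fun _ _ h => h)
    rw [← sum_map_length]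
  -- New vertices are appended behind `Q`, so the cells being scanned do not change.
  · rintro l s' - ⟨N, -, h, -, -, -⟩ i hi
    have h5 := h i (by rw [List.length_append]; omega)
    have h6 := hQ4 i hi
    rw [zero_add] at h5 h6
    rw [h5, h6, List.getElem_append_left]
  · intro l t l' s' hl hf hs' h8
    have htn : t < n := hQ t (List.mem_of_mem_drop (i := a) (by rw [hl]; simp))
    have hin' : HasInput B n adj s' := hin.frame hf rfl rfl rfl rfl rfl
    have h13 : s'.reg 13 = b := (hf.reg 13 rfl).trans hb
    refine Runs.wp_seq (p := .const 15 0) (T := (adj t).length * 13 + 9) ?_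
      (by simp [Prog.cost]; omega)
    refine ⟨by omega, ?_⟩
    have hf₀ : Frame (.const 15 0) s' (s'.setReg 15 0) :=
      (Exec.const (B := B) s' 15 0 (by omega)).frame
    refine Runs.seq (Runs.scanAdj hA (hin'.frame hf₀ rfl rfl rfl rfl rfl) (by simpa using h8) htn
      (fun m s'' => s''.reg 15 = if b ∈ m then 1 else 0) 2 rfl rfl rfl rfl (by simp) (by simp) ?_)
      (T₂ := (adj t).length * 8 + 5) (fun s₂ hf₂ h15 => ?_) (by omega)
    · intro m v m' s'' hm hf' hs'' hv
      have h1 : s''.reg 1 = 1 := (hf'.reg 1 rfl).trans hin'.reg1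
      have h13' : s''.reg 13 = b := (hf'.reg 13 rfl).trans h13
      refine Runs.of_wp (p := .ite (.eq 11 13) (.move 15 1) .skip) ?_
      by_cases hvb : v = b
      · simp [Prog.wp, Test.Holds, hv, h13', hvb, h1]; omega
      · simp [Prog.wp, Test.Holds, hv, h13', hvb, hs'', Ne.symm hvb]
    · have hin₂ := (hin'.frame hf₀ rfl rfl rfl rfl rfl).frame hf₂ rfl rfl rfl rfl rfl
      have hs₂ := hs'.congr (s' := s₂) (fun _ => Iff.rfl) (hf₂.reg 5 rfl) (hf₂.arr 4 rfl)
        (hf₂.arr 3 rfl)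
      refine Runs.ite (T := (adj t).length * 8 + 4) (fun hc => ?_) (fun hc => ?_)
      · have hbt : b ∉ adj t := by simpa [Test.Holds, h15, hin₂.reg2] using hc
        refine Runs.mono (Runs.scanAdj (body := expelBody) hA hin₂
          ((hf₂.reg 8 rfl).trans (by simpa using h8)) htn
          (fun m => Expelled n Q fun v => (∃ t ∈ l, v ∈ adj t ∧ b ∉ adj t) ∨ v ∈ m) 5
          rfl rfl rfl rfl (hs₂.congr (by simp) rfl rfl rfl)
          (fun m s k h => ⟨h.congr (fun _ => Iff.rfl) rfl rfl rfl,
            h.congr (fun _ => Iff.rfl) rfl rfl rfl, h.congr (fun _ => Iff.rfl) rfl rfl rfl⟩)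
          ?_) le_rfl (fun s₃ _ h => h.congr (fun w => ?_) rfl rfl rfl)
        · intro m v m' s₃ hm hf₃ hs₃ hv
          refine (expelBody_runs hs₃ hQ ((hf₃.reg 1 rfl).trans hin₂.reg1)
            ((hf₃.reg 2 rfl).trans hin₂.reg2) hv (hA.lt (t := t) (by rw [hm]; simp)) hBn).mono
            le_rfl (fun s₄ _ h => h.congr (fun w => ?_) rfl rfl rfl)
          simp [or_assoc]
        · simp [hbt, or_and_right, exists_or]
      · have hbt : b ∈ adj t := by simpa [Test.Holds, h15, hin₂.reg2] using hc
        have : Expelled n Q (fun v => ∃ t' ∈ l ++ [t], v ∈ adj t' ∧ b ∉ adj t') s₂ :=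
          hs₂.congr (fun w => by simp [hbt, or_and_right, exists_or]) rfl rfl rfl
        exact (Runs.of_wp (B := B) (p := .skip) (s := s₂)
          (Q := Expelled n Q fun v => ∃ t' ∈ l ++ [t], v ∈ adj t' ∧ b ∉ adj t') this).mono
          (by simp [Prog.cost]) (fun _ _ h => h)

/-- The parents after a round. -/
def NewParents (n : ℕ) (adj : ℕ → List ℕ) (Q T : List ℕ) (p p' : ℕ → ℕ) : Prop :=
  (∀ v, ¬ (p v = 0 ∧ v < n ∧ v ∉ Q ∧ ∃ t ∈ T, v ∈ adj t) → p' v = p v) ∧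
    ∀ v, p v = 0 → v < n → v ∉ Q → (∃ t ∈ T, v ∈ adj t) → ∃ t ∈ T, v ∈ adj t ∧ p' v = t + 1

/-- The constants add the costs of counting, choosing, resetting and expelling; the number of
touched vertices is at most the volume of the unprocessed part. -/
theorem refineRound_runs {s : Mem} {Q : List ℕ} {a : ℕ} (hA : AdjLists n adj)
    (hin : HasInput B n adj s) (hQ : AtQueue n Q a s) (hex : ∃ v < n, v ∉ Q)
    (hB : volume adj (Q.drop a) + 1 ≤ B) :
    Runs B refineRound s (volume adj (Q.drop a) * 40 + (Q.drop a).length * 20 + 15) fun s' =>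
      ∃ y b N, Chosen n adj Q (Q.drop a) y b ∧ AtQueue n (Q ++ N) Q.length s' ∧
        (∀ v, v ∈ N ↔ v < n ∧ v ∉ Q ∧ ∃ t ∈ Q.drop a, v ∈ adj t ∧ b ∉ adj t) ∧
        NewParents n adj Q (Q.drop a) (s.arr 7) (s'.arr 7) := by
  have hBn := hin.succ_le
  have ht := touch_runs hA hin hQ hB
  rw [sum_map_length] at ht
  refine ht.seq (T₂ := volume adj (Q.drop a) * 24 + (Q.drop a).length * 13 + 12)
    (fun s₁ hf₁ hT => ?_) (by omega)
  have hin₁ := hin.frame hf₁ rfl rfl rfl rfl rfl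
  refine (choose_runs hA hin₁ hQ hex hf₁ hB hT).seq
    (T₂ := volume adj (Q.drop a) * 17 + (Q.drop a).length * 13 + 6) ?_ (by omega)
  rintro s₂ hf₂ ⟨y, hy⟩
  have hin₂ := hin₁.frame hf₂ rfl rfl rfl rfl rfl
  obtain ⟨U, hU1, hU2, hU3, hU4, hU5⟩ := hT.list
  refine (resetCounters_runs (U := U) hin₂ ((hf₂.reg 6 rfl).trans hU1)
    (by rw [hf₂.arr 5 rfl]; exact hU2) hU3
    (fun v hv => ((hQ.flag_iff v).1 ((hU4 v).1 hv).1).1) (fun v hv => ?_)).seq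
    (T₂ := volume adj (Q.drop a) * 13 + (Q.drop a).length * 13 + 4)
    (fun s₃ hf₃ h6 => ?_) (by simp only [volume] at *; omega)
  · rw [hf₂.arr 6 rfl, hT.cnt] at hv
    split_ifs at hv with h3
    · exact (hU4 v).2 ⟨h3, by simpa [List.count_eq_zero] using hv⟩
    · exact absurd rfl hv
  have hin₃ := hin₂.frame hf₃ rfl rfl rfl rfl rfl
  have hr : ∀ x, touch.writesReg x = false → choose.writesReg x = false →
      resetCounters.writesReg x = false → s₃.reg x = s.reg x := fun x h1 h2 h3 =>
    (hf₃.reg x h3).trans ((hf₂.reg x h2).trans (hf₁.reg x h1))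
  have hr' : ∀ x, touch.writesArr x = false → choose.writesArr x = false →
      resetCounters.writesArr x = false → s₃.arr x = s.arr x := fun x h1 h2 h3 =>
    (hf₃.arr x h3).trans ((hf₂.arr x h2).trans (hf₁.arr x h1))
  have hst : Stores (s₃.arr 4) 0 Q := by rw [hr' 4 rfl rfl rfl]; exact hQ.stores
  refine (expel_runs (Q := Q) (a := a) hA hin₃ ((hr 3 rfl rfl rfl).trans hQ.reg3)
    ((hr 4 rfl rfl rfl).trans hQ.reg4) hQ.le hQ.lt hst (hf₃.reg 13 rfl) ⟨[], ?_, ?_, ?_, ?_, ?_⟩).seq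
    (T₂ := 2) ?_ (by omega)
  · simpa using (hr 5 rfl rfl rfl).trans hQ.reg5
  · simpa using hst
  · simpa using hQ.nodup
  · rw [hr' 3 rfl rfl rfl]
    simpa using hQ.flag
  · simp
  rintro s₄ hf₄ ⟨N, hN1, hN2, hN3, hN4, hN5⟩
  have h4 : s₄.reg 4 = Q.length := (hf₄.reg 4 rfl).trans ((hr 4 rfl rfl rfl).trans hQ.reg4)
  have hNlt : ∀ v ∈ Q ++ N, v < n := by
    intro v hv
    rcases List.mem_append.1 hv with h | h
    exacts [hQ.lt v h, ((hN5 v).1 h).1]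
  have hNn := length_le_of_nodup hN3 hNlt
  have h7 : s₄.arr 7 = s₁.arr 7 := by
    rw [hf₄.arr 7 rfl, hf₃.arr 7 rfl, hf₂.arr 7 rfl]
  have hmem : ∀ v, (s.arr 7 v = 0 ∧ s.arr 3 v = 1 ∧ v ∈ (Q.drop a).flatMap adj) ↔
      (s.arr 7 v = 0 ∧ v < n ∧ v ∉ Q ∧ ∃ t ∈ Q.drop a, v ∈ adj t) := by
    intro v
    rw [hQ.flag_iff, List.mem_flatMap, and_assoc]
  have hpar : NewParents n adj Q (Q.drop a) (s.arr 7) (s₄.arr 7) := by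
    rw [h7]
    exact ⟨fun v hv => hT.par_old v (by rwa [hmem]), fun v h0 hv hvQ hvt =>
      hT.par_new v h0 ((hmem v).2 ⟨h0, hv, hvQ, hvt⟩).2.1 ((hmem v).2 ⟨h0, hv, hvQ, hvt⟩).2.2⟩
  refine Runs.of_wp (p := .seq (.move 3 4) (.move 4 5)) ⟨?_, ?_, ?_⟩
  · rw [h4]; simp only [List.length_append] at hNn; omega
  · simp [hN1]; simp only [List.length_append] at hNn; omega
  · refine ⟨y, _, N, hy, ⟨by simp [h4], by simp [hN1], by simp [hN1], by simp, hN3, hNlt, ?_, ?_,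
      ?_, ?_⟩, hN5, ?_⟩
    · simpa using hN2
    · simpa using hN4
    · simp [hf₄.arr 6 rfl, h6]
    · intro v
      simp only [Mem.setReg_arr]
      by_cases hc : s.arr 7 v = 0 ∧ v < n ∧ v ∉ Q ∧ ∃ t ∈ Q.drop a, v ∈ adj t
      · obtain ⟨t, ht, -, e⟩ := hpar.2 v hc.1 hc.2.1 hc.2.2.1 hc.2.2.2
        have := hQ.lt t (List.mem_of_mem_drop ht)
        omega
      · rw [hpar.1 v hc]
        exact hQ.par v
    · simpa using hpar

/-! ### The combinatorics of the refinement -/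

/-- `lev` is a level function with base `A`: its values at adjacent vertices differ by at most one,
and the parent `p v - 1` of a vertex `v` outside `A` is a neighbour of `v` on the level below. -/
structure IsLevel (n : ℕ) (adj : ℕ → List ℕ) (A : ℕ → Prop) (p lev : ℕ → ℕ) : Prop where
  base : ∀ v, A v → lev v = 0 ∧ p v = 0
  le : ∀ u < n, ∀ v ∈ adj u, lev v ≤ lev u + 1
  parent : ∀ v < n, ¬ A v → ∃ t ∈ adj v, p v = t + 1 ∧ lev v = lev t + 1

/-- A level function on the queue `Q`, whose part from index `a` on is the last level. -/
structure IsPartialLevel (n : ℕ) (adj : ℕ → List ℕ) (A : ℕ → Prop) (Q : List ℕ) (a : ℕ)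
    (p lev : ℕ → ℕ) (k : ℕ) : Prop where
  base : ∀ v, A v → lev v = 0 ∧ p v = 0
  le_top : ∀ u ∈ Q, lev u ≤ k
  top : ∀ u ∈ Q.drop a, lev u = k
  closed : ∀ u ∈ Q.take a, ∀ v ∈ adj u, v ∈ Q
  le : ∀ u ∈ Q, ∀ v ∈ adj u, v ∈ Q → lev v ≤ lev u + 1
  none : ∀ v < n, v ∉ Q → p v = 0
  parent : ∀ v ∈ Q, ¬ A v → ∃ t ∈ adj v, t ∈ Q ∧ p v = t + 1 ∧ lev v = lev t + 1

/-- The combinatorial invariant of the refinement. -/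
structure RefineInv (n : ℕ) (adj : ℕ → List ℕ) (A : ℕ → Prop) (Q : List ℕ) (a : ℕ)
    (p : ℕ → ℕ) : Prop where
  base : ∀ v, A v → v ∈ Q
  ex : ∃ v < n, v ∉ Q
  module : ∀ t ∈ Q.take a, ∀ y < n, y ∉ Q → ∀ y' < n, y' ∉ Q → y ∈ adj t → y' ∈ adj t
  rank : ∀ u ∈ Q, ¬ A u → ∀ y < n, y ∉ Q → y ∉ adj u →
    ∃ r ∈ Q, r ∈ adj u ∧ y ∉ adj r ∧ Q.idxOf r < Q.idxOf u
  level : ∃ lev, IsLevel n adj A p lev ∨ ∃ k, IsPartialLevel n adj A Q a p lev k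

theorem count_flatMap_le {adj : ℕ → List ℕ} (hnd : ∀ t, (adj t).Nodup) {u y : ℕ} {T : List ℕ}
    (h : ∀ t ∈ T, u ∈ adj t → y ∈ adj t) : (T.flatMap adj).count u ≤ (T.flatMap adj).count y := by
  induction T with
  | nil => simp
  | cons t T ih =>
    simp only [List.flatMap_cons, List.count_append]
    refine add_le_add ?_ (ih fun t ht => h t (List.mem_cons_of_mem _ ht))
    have := h t List.mem_cons_self
    rw [List.Nodup.count (hnd t), List.Nodup.count (hnd t)]
    split_ifs <;> first | omega | tauto

/-- As the lists have no repetitions, the counts are the sizes of the two neighbourhoods in `T`; an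
inclusion between them that does not increase the size is an equality. -/
theorem mem_of_count_flatMap_le {adj : ℕ → List ℕ} (hnd : ∀ t, (adj t).Nodup) {u y : ℕ}
    {T : List ℕ} (h : ∀ t ∈ T, u ∈ adj t → y ∈ adj t)
    (hc : (T.flatMap adj).count y ≤ (T.flatMap adj).count u) :
    ∀ t ∈ T, y ∈ adj t → u ∈ adj t := by
  induction T with
  | nil => simp
  | cons t T ih =>
    simp only [List.flatMap_cons, List.count_append] at hc
    have hT := fun t ht => h t (List.mem_cons_of_mem _ ht)
    have h1 := count_flatMap_le hnd hT
    have h2 := h t List.mem_cons_self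
    rw [List.Nodup.count (hnd t), List.Nodup.count (hnd t)] at hc
    intro t' ht' hy
    rcases List.mem_cons.1 ht' with rfl | ht'
    · by_contra hu
      rw [if_pos hy, if_neg hu] at hc
      omega
    · refine ih hT ?_ t' ht' hy
      split_ifs at hc <;> first | omega | tauto

/-- The vertices that stay outside have the same neighbours in `T` as `y`, which extends the module
property. The neighbour `t` that causes an expulsion is not adjacent to `y`, hence to no vertex that
stays, and its position in the queue is smaller; this gives the rank. Levels are extended in
breadth-first order until all outside vertices are touched together. -/
theorem RefineInv.step (hA : AdjLists n adj) {A : ℕ → Prop} {Q N : List ℕ} {a y b : ℕ}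
    {p p' : ℕ → ℕ} (h : RefineInv n adj A Q a p) (hQ : ∀ v ∈ Q, v < n)
    (hy : Chosen n adj Q (Q.drop a) y b)
    (hN : ∀ v, v ∈ N ↔ v < n ∧ v ∉ Q ∧ ∃ t ∈ Q.drop a, v ∈ adj t ∧ b ∉ adj t)
    (hp : NewParents n adj Q (Q.drop a) p p') : RefineInv n adj A (Q ++ N) Q.length p' := by
  obtain ⟨hyn, hyQ, -, hyb, hmin⟩ := hy
  -- The register may hold the substitute `b = n`; on `T` it behaves like the actual vertex `y`.
  have hN' : ∀ v, v ∈ N ↔ v < n ∧ v ∉ Q ∧ ∃ t ∈ Q.drop a, v ∈ adj t ∧ y ∉ adj t := by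
    intro v
    rw [hN]
    refine and_congr_right fun _ => and_congr_right fun _ => exists_congr fun t =>
      and_congr_right fun ht => by rw [hyb t ht]
  have hsub : ∀ v < n, v ∉ Q ++ N → v ∉ Q ∧ ∀ t ∈ Q.drop a, v ∈ adj t → y ∈ adj t := by
    intro v hv hvQ
    rw [List.mem_append, not_or] at hvQ
    refine ⟨hvQ.1, fun t ht hvt => ?_⟩
    by_contra hyt
    exact hvQ.2 ((hN' v).2 ⟨hv, hvQ.1, t, ht, hvt, hyt⟩)
  have hsup : ∀ v < n, v ∉ Q ++ N → ∀ t ∈ Q.drop a, y ∈ adj t → v ∈ adj t := by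
    intro v hv hvQ
    obtain ⟨h1, h2⟩ := hsub v hv hvQ
    rcases hmin with h3 | ⟨-, h3⟩
    · exact fun t ht hyt => absurd hyt (h3 t ht)
    · exact mem_of_count_flatMap_le hA.nodup h2 (h3 v hv h1)
  have htd : ∀ t ∈ Q, t ∈ Q.take a ∨ t ∈ Q.drop a := by
    intro t ht
    rwa [← List.take_append_drop a Q, List.mem_append] at ht
  refine ⟨fun v hv => List.mem_append_left _ (h.base v hv), ⟨y, hyn, ?_⟩, ?_, ?_, ?_⟩
  · rw [List.mem_append, hN']
    rintro (h1 | ⟨-, -, t, -, h1, h2⟩)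
    exacts [hyQ h1, h2 h1]
  · rw [List.take_left]
    intro t ht v hv hvQ v' hv' hvQ' hvt
    rcases htd t ht with ht' | ht'
    · exact h.module t ht' v hv (hsub v hv hvQ).1 v' hv' (hsub v' hv' hvQ').1 hvt
    · exact hsup v' hv' hvQ' t ht' ((hsub v hv hvQ).2 t ht' hvt)
  · intro u hu huA v hv hvQ hvu
    rcases List.mem_append.1 hu with huQ | huN
    · obtain ⟨r, hr, hru, hvr, hlt⟩ := h.rank u huQ huA v hv (hsub v hv hvQ).1 hvu
      refine ⟨r, List.mem_append_left _ hr, hru, hvr, ?_⟩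
      rwa [List.idxOf_append_of_mem hr, List.idxOf_append_of_mem huQ]
    · obtain ⟨-, huQ, t, ht, hut, hyt⟩ := (hN' u).1 huN
      have htQ := List.mem_of_mem_drop ht
      refine ⟨t, List.mem_append_left _ htQ, hA.symm hut,
        fun hvt => hyt ((hsub v hv hvQ).2 t ht hvt), ?_⟩
      rw [List.idxOf_append_of_mem htQ, List.idxOf_append_of_notMem huQ]
      have := List.idxOf_lt_length_of_mem htQ
      omega
  · obtain ⟨lev, hl | ⟨k, hl⟩⟩ := h.level
    · refine ⟨lev, Or.inl ?_⟩
      -- Once the level function is complete, every vertex outside the base has a nonzero parent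
      -- entry, so later rounds leave the parents as they are.
      have hpp : ∀ v < n, v ∉ Q → p' v = p v := by
        intro v hv hvQ
        refine hp.1 v fun hc => ?_
        obtain ⟨t, -, h1, -⟩ := hl.parent v hv (fun hvA => hvQ (h.base v hvA))
        omega
      have hpp' : ∀ v, p' v = p v := by
        intro v
        by_cases hc : v < n ∧ v ∉ Q
        · exact hpp v hc.1 hc.2
        · exact hp.1 v fun h => hc ⟨h.2.1, h.2.2.1⟩
      obtain rfl : p' = p := funext hpp'
      exact hl
    · have hpQ : ∀ v ∈ Q, p' v = p v := fun v hv => hp.1 v fun h => h.2.2.1 hv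
      classical
      -- the vertices that are touched form the next level
      have hout : ∀ u ∈ Q, ∀ v ∈ adj u, v ∉ Q → u ∈ Q.drop a := fun u hu v hv hvQ =>
        (htd u hu).resolve_left fun hu' => hvQ (hl.closed u hu' v hv)
      have hnew : ∀ v < n, v ∉ Q → (∃ t ∈ Q.drop a, v ∈ adj t) →
          ∃ t ∈ adj v, p' v = t + 1 ∧ t ∈ Q ∧ lev t = k := by
        intro v hv hvQ hvt
        obtain ⟨t, ht, h1, h2⟩ := hp.2 v (hl.none v hv hvQ) hv hvQ hvt
        exact ⟨t, hA.symm h1, h2, List.mem_of_mem_drop ht, hl.top t ht⟩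
      -- Every outside vertex receives the next level. If the function stays partial, the values
      -- outside the prolonged queue are irrelevant, and later rounds replace them.
      refine ⟨fun v => if v ∈ Q then lev v else k + 1, ?_⟩
      have hbase : ∀ v, A v → (if v ∈ Q then lev v else k + 1) = 0 ∧ p' v = 0 := by
        intro v hv
        rw [if_pos (h.base v hv), hpQ v (h.base v hv)]
        exact hl.base v hv
      have hpar : ∀ v < n, ¬ A v → (v ∈ Q ∨ ∃ t ∈ Q.drop a, v ∈ adj t) → ∃ t ∈ adj v, t ∈ Q ∧
          p' v = t + 1 ∧ (if v ∈ Q then lev v else k + 1) = (if t ∈ Q then lev t else k + 1) + 1 := by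
        intro v hv hvA hvt
        by_cases hvQ : v ∈ Q
        · obtain ⟨t, ht, htQ, h1, h2⟩ := hl.parent v hvQ hvA
          exact ⟨t, ht, htQ, by rw [hpQ v hvQ, h1], by rw [if_pos hvQ, if_pos htQ, h2]⟩
        · obtain ⟨t, ht, h1, h2, h3⟩ := hnew v hv hvQ (hvt.resolve_left hvQ)
          exact ⟨t, ht, h2, h1, by rw [if_neg hvQ, if_pos h2, h3]⟩
      have hle : ∀ u ∈ Q, ∀ v ∈ adj u,
          (if v ∈ Q then lev v else k + 1) ≤ (if u ∈ Q then lev u else k + 1) + 1 := by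
        intro u hu v hv
        rw [if_pos hu]
        split_ifs with hvQ
        · exact hl.le u hu v hv hvQ
        · rw [hl.top u (hout u hu v hv hvQ)]
      have hle' : ∀ u, u ∉ Q → ∀ v,
          (if v ∈ Q then lev v else k + 1) ≤ (if u ∈ Q then lev u else k + 1) + 1 := by
        intro u hu v
        rw [if_neg hu]
        split_ifs with hvQ
        · exact (hl.le_top v hvQ).trans (by omega)
        · omega
      -- If `y` is untouched, all touched vertices are expelled and the search goes on with a full
      -- new level. Otherwise every outside vertex has a neighbour on level `k`, and the level
      -- function is complete.
      rcases hmin with h3 | ⟨h3, -⟩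
      · have htN : ∀ v < n, v ∉ Q → ∀ t ∈ Q.drop a, v ∈ adj t → v ∈ N := fun v hv hvQ t ht hvt =>
          (hN' v).2 ⟨hv, hvQ, t, ht, hvt, h3 t ht⟩
        refine Or.inr ⟨k + 1, hbase, ?_, ?_, ?_, ?_, ?_, ?_⟩
        · intro u _
          split_ifs with hu
          · exact (hl.le_top u hu).trans (by omega)
          · omega
        · intro u hu
          rw [List.drop_left] at hu
          exact if_neg ((hN' u).1 hu).2.1
        · intro u hu v hv
          rw [List.take_left] at hu
          by_cases hvQ : v ∈ Q
          · exact List.mem_append_left _ hvQ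
          · exact List.mem_append_right _ (htN v (hA.lt hv) hvQ u (hout u hu v hv hvQ) hv)
        · intro u _ v hv _
          by_cases hu : u ∈ Q
          · exact hle u hu v hv
          · exact hle' u hu v
        · intro v hv hvQ
          rw [List.mem_append, not_or] at hvQ
          rw [hp.1 v fun hc => ?_]
          · exact hl.none v hv hvQ.1
          · obtain ⟨t, ht, hvt⟩ := hc.2.2.2
            exact hvQ.2 (htN v hv hvQ.1 t ht hvt)
        · intro v hv hvA
          have : v < n ∧ (v ∈ Q ∨ ∃ t ∈ Q.drop a, v ∈ adj t) := by
            rcases List.mem_append.1 hv with hv | hv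
            · exact ⟨hQ v hv, Or.inl hv⟩
            · obtain ⟨h1, -, t, ht, hvt, -⟩ := (hN' v).1 hv
              exact ⟨h1, Or.inr ⟨t, ht, hvt⟩⟩
          obtain ⟨t, h1, h2, h4⟩ := hpar v this.1 hvA this.2
          exact ⟨t, h1, List.mem_append_left _ h2, h4⟩
      · refine Or.inl ⟨hbase, fun u _ v hv => ?_, fun v hv hvA => ?_⟩
        · by_cases hu : u ∈ Q
          · exact hle u hu v hv
          · exact hle' u hu v
        · obtain ⟨t, h1, -, h4⟩ := hpar v hv hvA (by
            by_cases hvQ : v ∈ Q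
            exacts [Or.inl hvQ, Or.inr (h3 v hv hvQ)])
          exact ⟨t, h1, h4⟩

/-- The result of a refinement that started from the set `A`: a nonempty module `S` disjoint from
`A`, a rank function that leads from every other vertex to `A` while avoiding the neighbours of any
member of `S`, and a level function. -/
structure Refined (n : ℕ) (adj : ℕ → List ℕ) (A S : ℕ → Prop) (p : ℕ → ℕ) : Prop where
  ex : ∃ v, S v
  lt : ∀ v, S v → v < n
  disj : ∀ v, S v → ¬ A v
  module : ∀ t < n, ¬ S t → ∀ y y', S y → S y' → y ∈ adj t → y' ∈ adj t
  rank : ∃ rk : ℕ → ℕ, ∀ u < n, ¬ S u → ¬ A u → ∀ y, S y → y ∉ adj u →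
    ∃ r, ¬ S r ∧ r ∈ adj u ∧ y ∉ adj r ∧ rk r < rk u
  level : ∃ lev, IsLevel n adj A p lev

/-- When the whole queue has been processed, its complement is the module. A level function that was
still partial would make the queue closed under adjacency, contrary to connectedness. -/
theorem RefineInv.refined {A : ℕ → Prop} {Q : List ℕ} {p : ℕ → ℕ}
    (h : RefineInv n adj A Q Q.length p)
    (hconn : ∀ X : ℕ → Prop, (∃ u < n, X u) → (∃ v < n, ¬ X v) → ∃ u v, X u ∧ ¬ X v ∧ v ∈ adj u)
    (hAex : ∃ v < n, A v) :
    Refined n adj A (fun v => v < n ∧ v ∉ Q) p := by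
  have hin : ∀ t < n, ¬ (t < n ∧ t ∉ Q) → t ∈ Q := fun t ht h => by tauto
  refine ⟨h.ex, fun v hv => hv.1, fun v hv hvA => hv.2 (h.base v hvA), ?_, ⟨Q.idxOf, ?_⟩, ?_⟩
  · intro t ht htS y y' hy hy' hyt
    refine h.module t ?_ y hy.1 hy.2 y' hy'.1 hy'.2 hyt
    rw [List.take_length]
    exact hin t ht htS
  · intro u hu huS huA y hy hyu
    obtain ⟨r, h1, h2, h3, h4⟩ := h.rank u (hin u hu huS) huA y hy.1 hy.2 hyu
    exact ⟨r, fun h => h.2 h1, h2, h3, h4⟩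
  · obtain ⟨lev, hl | ⟨k, hl⟩⟩ := h.level
    · exact ⟨lev, hl⟩
    · obtain ⟨a, ha, haA⟩ := hAex
      obtain ⟨u, v, hu, hv, huv⟩ := hconn (· ∈ Q) ⟨a, ha, h.base a haA⟩ h.ex
      exact absurd (hl.closed u (by rwa [List.take_length]) v huv) hv

/-! ### Initialization and a complete sweep -/

/-- The set that is marked in array `3`; all counters are zero, and the entries of the parent array
are small. -/
structure Marked (n : ℕ) (A : ℕ → Prop) (s : Mem) : Prop where
  lt : ∀ v, A v → v < n
  flag : ∀ v, A v → s.arr 3 v = 1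
  flag' : ∀ v, ¬ A v → s.arr 3 v = 0
  cnt : ∀ v, s.arr 6 v = 0
  par : ∀ v, s.arr 7 v ≤ n

/-- Array `3` is complemented, from the start set to the outside of the queue. After the sweep it
marks the module found, so the output of one sweep has the form required as input of the next. -/
theorem refineInit_runs {A : ℕ → Prop} {s : Mem} (hin : HasInput B n adj s)
    (hM : Marked n A s) (hex : ∃ v < n, ¬ A v) :
    Runs B refineInit s (n * 8 + 5) fun s' => ∃ Q, AtQueue n Q 0 s' ∧
      RefineInv n adj A Q 0 (s'.arr 7) := by
  classical
  have hBn := hin.succ_le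
  unfold refineInit
  refine Runs.wp_seq (p := .const 5 0) (T := n * 8 + 4) ⟨by omega, ?_⟩
    (by simp [Prog.cost]; omega)
  refine Runs.wp_seq (p := .const 7 0) (T := n * 8 + 3) ⟨by omega, ?_⟩
    (by simp [Prog.cost]; omega)
  have key := Runs.range (B := B) (ri := 7) (rk := 0) (s₀ := (s.setReg 5 0).setReg 7 0)
    (body := .seq (.load 12 3 7) <| .seq
      (.ite (.eq 12 1) (.seq (.store 3 7 2) <| .seq (.store 4 5 7) (.add 5 5 1)) (.store 3 7 1))
      (.store 7 7 2))
    (fun i s' => ∃ Q : List ℕ, s'.reg 5 = Q.length ∧ Stores (s'.arr 4) 0 Q ∧ Q.Nodup ∧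
      (∀ v, v ∈ Q ↔ v < i ∧ A v) ∧
      (∀ v, s'.arr 3 v = if v < i then (if A v then 0 else 1) else (if A v then 1 else 0)) ∧
      ∀ v, s'.arr 7 v = if v < i then 0 else s.arr 7 v) (fun _ => 6)
    (a := 0) (b := n) (by simp) (by simp [hin.reg0]) (by omega) (by omega) (by simp [hin.reg1])
    (by decide) (by decide) rfl rfl rfl ⟨[], by simp, Stores.nil _ _, by simp, by simp, ?_⟩
    (by simp) ?_
  · refine key.seq (T₂ := 2) ?_ (by simp)
    rintro s' hf ⟨Q, h1, h2, h3, h4, h5, h6⟩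
    have hQlt : ∀ v ∈ Q, v < n := fun v hv => ((h4 v).1 hv).1
    have hQn := length_le_of_nodup h3 hQlt
    refine Runs.of_wp (p := .seq (.const 3 0) (.move 4 5)) ⟨by omega, ?_, Q, ?_, ?_⟩
    · simp [h1]; omega
    · refine ⟨by simp, by simp [h1], by simp [h1], by omega, h3, hQlt, h2, fun v => ?_, fun v => ?_,
        fun v => ?_⟩
      · simp only [Mem.setReg_arr]
        rw [h5]
        by_cases hv : v < n
        · by_cases hvA : A v <;> simp [hv, hvA, h4]
        · simp [hv, show ¬ A v from fun h => hv (hM.lt v h)]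
      · simp only [Mem.setReg_arr]
        rw [hf.arr 6 rfl]
        exact hM.cnt v
      · simp only [Mem.setReg_arr]
        rw [h6]
        split_ifs
        · omega
        · exact hM.par v
    · obtain ⟨v, hv, hvA⟩ := hex
      refine ⟨fun v hv => (h4 v).2 ⟨hM.lt v hv, hv⟩, ⟨v, hv, fun h => hvA ((h4 v).1 h).2⟩, by simp,
        -- At the start the queue is `A` itself: rank and parent conditions are vacuous, and all of
        -- it is the last level, with number `0`.
        fun u hu huA => absurd ((h4 u).1 hu).2 huA, fun _ => 0, Or.inr ⟨0, ?_, by simp, by simp,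
        by simp, by simp, ?_, fun u hu huA => absurd ((h4 u).1 hu).2 huA⟩⟩
      · intro v hv
        simp [h6, hM.lt v hv]
      · intro v hv _
        simp [h6, hv]
  · refine ⟨fun v => ?_, by simp⟩
    by_cases hv : A v
    · simp [hv, hM.flag]
    · simp [hv, hM.flag']
  · rintro i s' - hi hf h7 ⟨Q, h1, h2, h3, h4, h5, h6⟩
    have hr1 : s'.reg 1 = 1 := (hf.reg 1 rfl).trans hin.reg1
    have hr2 : s'.reg 2 = 0 := (hf.reg 2 rfl).trans hin.reg2
    have hQn := length_le_of_nodup h3 fun v hv => (((h4 v).1 hv).1.trans hi)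
    have hflag := h5 i
    rw [if_neg (lt_irrefl i)] at hflag
    have hpar : ∀ v, Function.update (s'.arr 7) i 0 v = if v < i + 1 then 0 else s.arr 7 v := by
      intro v
      rw [Function.update_apply, h6]
      split_ifs <;> first | rfl | omega
    simp only [Nat.lt_succ_iff] at hpar
    refine Runs.of_wp (p := .seq (.load 12 3 7) <| .seq
      (.ite (.eq 12 1) (.seq (.store 3 7 2) <| .seq (.store 4 5 7) (.add 5 5 1)) (.store 3 7 1))
      (.store 7 7 2)) ?_
    by_cases hiA : A i
    · rw [if_pos hiA] at hflag
      simp [Prog.wp, Test.Holds, h7, hflag, hr1, hr2, h1]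
      refine ⟨by omega, by omega, by omega, Q ++ [i], by simp, ?_, ?_, fun v => ?_, fun v => ?_,
        hpar⟩
      · simpa using h2.snoc i
      · refine List.nodup_append.2 ⟨h3, List.nodup_singleton _, ?_⟩
        rintro v hv w hw rfl
        rw [List.mem_singleton] at hw
        have := ((h4 v).1 hv).1
        omega
      · rw [List.mem_append, h4, List.mem_singleton, Nat.le_iff_lt_or_eq]
        constructor
        · rintro (h | rfl)
          exacts [⟨Or.inl h.1, h.2⟩, ⟨Or.inr rfl, hiA⟩]
        · rintro ⟨h | h, h'⟩
          exacts [Or.inl ⟨h, h'⟩, Or.inr h]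
      · rw [Function.update_apply, h5]
        by_cases hv : v = i
        · simp [hv, hiA]
        · simp [hv, show v ≤ i ↔ v < i by omega]
    · rw [if_neg hiA] at hflag
      simp [Prog.wp, Test.Holds, h7, hflag, hr1, hr2, h1]
      refine ⟨by omega, Q, rfl, h2, h3, fun v => ?_, fun v => ?_, hpar⟩
      · rw [h4]
        refine ⟨fun h => ⟨by omega, h.2⟩, fun h => ⟨lt_of_le_of_ne (by omega) ?_, h.2⟩⟩
        rintro rfl
        exact hiA h.2
      · rw [Function.update_apply, h5]
        by_cases hv : v = i
        · simp [hv, hiA]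
        · simp [hv, show v ≤ i ↔ v < i by omega]

theorem volume_append (adj : ℕ → List ℕ) (l l' : List ℕ) :
    volume adj (l ++ l') = volume adj l + volume adj l' := by
  simp [volume]

theorem volume_le {Q : List ℕ} (h : Q.Nodup) (hlt : ∀ v ∈ Q, v < n) :
    volume adj Q ≤ volume adj (List.range n) := by
  obtain ⟨l, hl, hl'⟩ :=
    List.subperm_of_subset h (l₂ := List.range n) fun v hv => List.mem_range.2 (hlt v hv)
  rw [volume, ← (hl.flatMap_right adj).length_eq]
  simp only [List.length_flatMap]
  exact (hl'.map _).sum_le_sum (by simp)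

theorem refineSet_runs {A : ℕ → Prop} {s : Mem} (hA : AdjLists n adj) (hin : HasInput B n adj s)
    (hconn : ∀ X : ℕ → Prop, (∃ u < n, X u) → (∃ v < n, ¬ X v) → ∃ u v, X u ∧ ¬ X v ∧ v ∈ adj u)
    (hB : volume adj (List.range n) + 1 ≤ B)
    (hM : Marked n A s) (hex : ∃ v < n, ¬ A v) (hAex : ∃ v, A v) :
    Runs B refineSet s (volume adj (List.range n) * 40 + n * 44 + 6) fun s' => ∃ S,
      Marked n S s' ∧ Refined n adj A S (s'.arr 7) := by
  refine (refineInit_runs hin hM hex).seq (T₂ := volume adj (List.range n) * 40 + n * 36 + 1)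
    (fun s₁ hf₁ h₁ => ?_) (by omega)
  have hin₁ := hin.frame hf₁ rfl rfl rfl rfl rfl
  -- The potential is the budget minus the charge for the vertices processed so far. Since `T` is
  -- nonempty in each round, the fixed cost `15` and the loop test are charged to its vertices,
  -- whence `36 = 20 + 15 + 1`.
  refine Runs.mono (Runs.loop (B := B) (s₀ := s₁)
    (fun s' => ∃ Q, AtQueue n Q (s'.reg 3) s' ∧ RefineInv n adj A Q (s'.reg 3) (s'.arr 7))
    (fun s' => volume adj (List.range n) * 40 + n * 36 -
      (volume adj ((List.range (s'.reg 3)).map (s'.arr 4)) * 40 + s'.reg 3 * 36)) ?_ ?_)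
    (Nat.add_le_add_right (Nat.sub_le _ _) 1) ?_
  · obtain ⟨Q, hQ, hI⟩ := h₁
    exact ⟨Q, by rwa [hQ.reg3], by rwa [hQ.reg3]⟩
  · rintro s₂ hf₂ ⟨Q, hQ, hI⟩ hlt
    have htake : ∀ {s' : Mem} {Q' : List ℕ} {a : ℕ}, Stores (s'.arr 4) 0 Q' → a ≤ Q'.length →
        (List.range a).map (s'.arr 4) = Q'.take a := by
      intro s' Q' a h ha
      refine List.ext_getElem (by simp [ha]) fun i hi _ => ?_
      have := h i (by simp at hi; omega)
      simpa using this
    have hlt' : s₂.reg 3 < Q.length := by simpa [Test.Holds, hQ.reg4] using hlt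
    have hvol := volume_le (adj := adj) hQ.nodup hQ.lt
    have hlen := length_le_of_nodup hQ.nodup hQ.lt
    have hsplit := volume_append adj (Q.take (s₂.reg 3)) (Q.drop (s₂.reg 3))
    rw [List.take_append_drop] at hsplit
    have hin₂ := hin₁.frame hf₂ rfl rfl rfl rfl rfl
    refine ⟨_, (refineRound_runs hA hin₂ hQ hI.ex (by omega)).mono le_rfl ?_⟩
    rintro s₃ - ⟨y, b, N, hy, hQ', hN, hp⟩
    have h3 := hQ'.reg3
    refine ⟨⟨Q ++ N, by rwa [h3], by rw [h3]; exact hI.step hA hQ.lt hy hN hp⟩, ?_⟩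
    rw [h3, htake hQ'.stores (by simp), htake hQ.stores hQ.le, List.take_left, List.length_drop]
    omega
  · rintro s' hf ⟨⟨Q, hQ, hI⟩, hnlt⟩
    have : s'.reg 3 = Q.length := by
      refine le_antisymm hQ.le ?_
      simpa [Test.Holds, hQ.reg4] using hnlt
    rw [this] at hI
    obtain ⟨v, hv⟩ := hAex
    refine ⟨_, ⟨fun v hv => hv.1, fun v hv => (hQ.flag_iff v).2 hv, fun v hv => ?_, hQ.cnt, hQ.par⟩,
      hI.refined hconn ⟨v, hM.lt v hv, hv⟩⟩
    rw [hQ.flag, if_neg hv]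

end WordRAM

namespace PairedDom

variable {V : Type*} {G : SimpleGraph V}

/-! ## Paths in asteroidal-triple-free graphs -/

theorem mem_closedNbhd {u v : V} : u ∈ closedNbhd G v ↔ u = v ∨ G.Adj v u := by
  simp [closedNbhd]

theorem mem_closedNbhd_comm {u v : V} : u ∈ closedNbhd G v ↔ v ∈ closedNbhd G u := by
  rw [mem_closedNbhd, mem_closedNbhd, eq_comm, G.adj_comm]

/-- There is a walk from `p` to `q` that avoids the closed neighbourhood of `r`. -/
def AvoidingWalk (G : SimpleGraph V) (p q r : V) : Prop :=
  ∃ P : G.Walk p q, ∀ w ∈ P.support, w ∉ closedNbhd G r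

theorem AvoidingWalk.avoidingPath {p q r : V} (h : AvoidingWalk G p q r) :
    AvoidingPath G p q r := by
  classical
  obtain ⟨P, hP⟩ := h
  exact ⟨P.bypass, P.bypass_isPath, fun w hw => hP w (P.support_bypass_subset_support hw)⟩

theorem AvoidingWalk.symm {p q r : V} (h : AvoidingWalk G p q r) : AvoidingWalk G q p r := by
  obtain ⟨P, hP⟩ := h
  exact ⟨P.reverse, fun w hw => hP w (by simpa using hw)⟩

theorem AvoidingWalk.trans {p q r u : V} (h : AvoidingWalk G p q r) (h' : AvoidingWalk G q u r) :
    AvoidingWalk G p u r := by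
  obtain ⟨P, hP⟩ := h
  obtain ⟨P', hP'⟩ := h'
  refine ⟨P.append P', fun w hw => ?_⟩
  rw [SimpleGraph.Walk.mem_support_append_iff] at hw
  exact hw.elim (hP w) (hP' w)

theorem AvoidingWalk.refl {p r : V} (h : p ∉ closedNbhd G r) : AvoidingWalk G p p r :=
  ⟨.nil, by simpa using h⟩

theorem AvoidingWalk.cons {p q u r : V} (hp : p ∉ closedNbhd G r) (ha : G.Adj p q)
    (h : AvoidingWalk G q u r) : AvoidingWalk G p u r := by
  obtain ⟨P, hP⟩ := h
  exact ⟨.cons ha P, by simpa using ⟨hp, hP⟩⟩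

/-- `S` is a nonempty module disjoint from `A`, and every vertex outside `S` can be joined to `A`
avoiding the closed neighbourhood of any of its non-neighbours in `S`. -/
structure IsFarModule (G : SimpleGraph V) (A S : Set V) : Prop where
  disj : Disjoint S A
  module : ∀ t ∉ S, ∀ y ∈ S, ∀ y' ∈ S, G.Adj t y → G.Adj t y'
  rank : ∃ rk : V → ℕ, ∀ u ∉ S, u ∉ A → ∀ y ∈ S, ¬ G.Adj u y →
    ∃ r ∉ S, G.Adj u r ∧ ¬ G.Adj r y ∧ rk r < rk u

/-- The neighbour supplied by the rank condition is again outside the module and not adjacent to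
`y`, so the step can be repeated; the decreasing rank forces an end in `A`. -/
theorem IsFarModule.exists_avoidingWalk {A S : Set V} (h : IsFarModule G A S) {u y : V}
    (hu : u ∉ S) (hy : y ∈ S) (huy : u ∉ closedNbhd G y) : ∃ a ∈ A, AvoidingWalk G u a y := by
  obtain ⟨rk, hrk⟩ := h.rank
  induction hn : rk u using Nat.strong_induction_on generalizing u with
  | _ n ih =>
    by_cases huA : u ∈ A
    · exact ⟨u, huA, .refl huy⟩
    have huy' : ¬ G.Adj u y := fun h => huy (mem_closedNbhd.2 (Or.inr h.symm))
    obtain ⟨r, hr, hur, hry, hlt⟩ := hrk u hu huA y hy huy'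
    have hry' : r ∉ closedNbhd G y := by
      rw [mem_closedNbhd]
      rintro (rfl | h)
      exacts [hr hy, hry h.symm]
    obtain ⟨a, ha, hw⟩ := ih (rk r) (hn ▸ hlt) hr hry' rfl
    exact ⟨a, ha, hw.cons huy hur⟩

/-- A walk that enters a module may enter it at any vertex. -/
theorem AvoidingWalk.change_end {X : Set V} {z a x y : V}
    (hX : ∀ t ∉ X, ∀ u ∈ X, ∀ u' ∈ X, G.Adj t u → G.Adj t u') (hz : z ∉ X) (ha : a ∈ X)
    (hx : x ∈ X) (hxy : x ∉ closedNbhd G y) (h : AvoidingWalk G z a y) : AvoidingWalk G z x y := by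
  obtain ⟨P, hP⟩ := h
  induction P with
  | nil => exact absurd ha hz
  | @cons u v w huv P ih =>
    simp only [SimpleGraph.Walk.support_cons, List.mem_cons, forall_eq_or_imp] at hP
    by_cases hv : v ∈ X
    · exact (AvoidingWalk.refl hxy).cons hP.1 (hX u hz v hv x hx huv)
    · exact (ih hv ha hP.2).cons hP.1 huv

/-- A path `q 0, …, q d` along which the level function `lev` decreases to zero. -/
structure IsDescent (G : SimpleGraph V) (lev : V → ℕ) (q : ℕ → V) (d : ℕ) : Prop where
  lev_le : ∀ u v, G.Adj u v → lev v ≤ lev u + 1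
  lev_eq : ∀ i ≤ d, lev (q i) + i = d
  adj : ∀ i < d, G.Adj (q i) (q (i + 1))

theorem IsDescent.inj {lev : V → ℕ} {q : ℕ → V} {d i j : ℕ} (h : IsDescent G lev q d)
    (hi : i ≤ d) (hj : j ≤ d) (hij : q i = q j) : i = j := by
  have h1 := h.lev_eq i hi
  have h2 := h.lev_eq j hj
  rw [hij] at h1
  omega

/-- An undominated `z` would form an asteroidal triple with the two ends of the descent. The module
properties keep `z` outside `X` and `Y`, so that the avoiding walks of both sweeps are available
from `z`. -/
theorem IsDescent.dominating {lev : V → ℕ} {q : ℕ → V} {d : ℕ} (h : IsDescent G lev q d)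
    (hG : ATFree G) {s : V} {X Y : Set V} (hX : IsFarModule G {s} X) (hY : IsFarModule G X Y)
    (hq₀ : q 0 ∈ Y) (hqd : q d ∈ X) (hlev : ∀ x ∈ X, lev x = 0) (z : V) :
    ∃ i ≤ d, z ∈ closedNbhd G (q i) := by
  by_contra! hz
  have hYX : ∀ v ∈ Y, v ∉ X := fun v hv hvX => Set.disjoint_left.1 hY.disj hv hvX
  have hd : 0 < d := by
    rcases Nat.eq_zero_or_pos d with rfl | hd
    · exact absurd hqd (hYX _ hq₀)
    · exact hd
  have hadj : ∀ i ≤ d, ¬ G.Adj (q i) z := fun i hi ha => hz i hi (mem_closedNbhd.2 (Or.inr ha))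
  have hzX : z ∉ X := by
    intro hzX
    obtain ⟨e, rfl⟩ : ∃ e, d = e + 1 := ⟨d - 1, by omega⟩
    have he : q e ∉ X := fun he => by
      have := hlev _ he
      have := h.lev_eq e (by omega)
      omega
    exact hadj e (by omega) (hX.module _ he _ hqd _ hzX (h.adj e (by omega)))
  have hq1 : q 1 ∉ Y := by
    -- Let `q i` be the first vertex of the path outside `Y`. It is adjacent to a vertex of `Y`,
    -- hence to `q 0`, as `Y` is a module. Levels of adjacent vertices differ by at most one, so `i
    -- = 1`.
    have hex : ∃ i, i ≤ d ∧ q i ∉ Y := ⟨d, le_rfl, fun hdY => hYX _ hdY hqd⟩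
    classical
    obtain ⟨hle, hnot⟩ := Nat.find_spec hex
    have hmin := fun m => Nat.find_min (H := hex) (m := m)
    generalize Nat.find hex = i at hle hnot hmin
    have hi0 : i ≠ 0 := by rintro rfl; exact hnot hq₀
    obtain ⟨e, rfl⟩ : ∃ e, i = e + 1 := ⟨i - 1, by omega⟩
    have heY : q e ∈ Y := by
      by_contra hne
      exact hmin e (by omega) ⟨by omega, hne⟩
    have ha := hY.module _ hnot _ heY _ hq₀ (h.adj e (by omega)).symm
    have h1 := h.lev_le _ _ ha
    have h2 := h.lev_eq 0 (by omega)
    have h3 := h.lev_eq (e + 1) hle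
    obtain rfl : e = 0 := by omega
    exact hnot
  have hzY : z ∉ Y := fun hzY =>
    hadj 1 hd (hY.module _ hq1 _ hq₀ _ hzY (by simpa using (h.adj 0 hd).symm))
  have hzy : z ∉ closedNbhd G (q 0) := hz 0 (by omega)
  have hzx : z ∉ closedNbhd G (q d) := hz d le_rfl
  have hyX := hYX _ hq₀
  obtain ⟨a, haX, hza⟩ := hY.exists_avoidingWalk hzY hq₀ hzy
  have hay : a ∉ closedNbhd G (q 0) := by
    obtain ⟨P, hP⟩ := hza
    exact hP a P.end_mem_support
  -- If `q 0` were adjacent to `q d`, it would be adjacent to all of `X`, in particular to the end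
  -- `a` of a walk that avoids `N[q 0]`.
  have hxy : q d ∉ closedNbhd G (q 0) := by
    rw [mem_closedNbhd]
    rintro (hxy | hxy)
    · exact hyX (hxy ▸ hqd)
    · exact hay (mem_closedNbhd.2 (Or.inr (hX.module _ hyX _ hqd _ haX hxy)))
  have hyx : q 0 ∉ closedNbhd G (q d) := fun h => hxy (mem_closedNbhd_comm.1 h)
  have W₁ : AvoidingWalk G z (q d) (q 0) := hza.change_end hX.module hzX haX hqd hxy
  -- The first sweep started from the single vertex `s`, so the walks from `q 0` and from `z` meet
  -- there.
  have W₂ : AvoidingWalk G (q 0) z (q d) := by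
    obtain ⟨a₁, h₁, w₁⟩ := hX.exists_avoidingWalk hyX hqd hyx
    obtain ⟨a₂, h₂, w₂⟩ := hX.exists_avoidingWalk hzX hqd hzx
    rw [Set.mem_singleton_iff] at h₁ h₂
    subst h₁ h₂
    exact w₁.trans w₂.symm
  have W₃ : ∀ i ≤ d, AvoidingWalk G (q i) (q 0) z := by
    intro i hi
    induction i with
    | zero => exact .refl fun h => hzy (mem_closedNbhd_comm.1 h)
    | succ i ih =>
      exact (ih (by omega)).cons (fun h => hz _ hi (mem_closedNbhd_comm.1 h)) (h.adj i hi).symm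
  rw [mem_closedNbhd, not_or] at hzy hzx hyx
  exact hG (q d) (q 0) z ⟨⟨Ne.symm hyx.1, Ne.symm hzy.1, Ne.symm hzx.1⟩, ⟨hyx.2, hzy.2, hzx.2⟩,
    (W₃ d le_rfl).avoidingPath, W₂.avoidingPath, W₁.symm.avoidingPath⟩

/-! ## The size of paired dominating sets -/

theorem IsPDSet.exists_mate {D : Finset V} (h : IsPDSet G D) :
    ∃ m : V → V, ∀ a ∈ D, m a ∈ D ∧ G.Adj a (m a) ∧ m (m a) = a := by
  obtain ⟨-, M, hM, hsp⟩ := h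
  have hm : ∀ a : (D : Set V), ∃ b : (D : Set V), M.Adj a b := fun a =>
    (hM (hsp a)).exists
  choose f hf using hm
  classical
  refine ⟨fun a => if ha : a ∈ D then f ⟨a, ha⟩ else a, fun a ha => ?_⟩
  have hfD : (f ⟨a, ha⟩ : V) ∈ D := (f ⟨a, ha⟩).2
  have hadj := hf ⟨a, ha⟩
  refine ⟨by simp [ha], by simpa [ha] using hadj.adj_sub, ?_⟩
  have := hM.eq_of_adj_left (hf (f ⟨a, ha⟩)) hadj.symm
  simp only [ha, dif_pos]
  rw [dif_pos hfD, this]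

theorem IsPDSet.even_card {D : Finset V} (h : IsPDSet G D) : Even D.card := by
  obtain ⟨-, M, hM⟩ := h
  have := hM.even_card
  simpa using this

/-- Double counting of pairs `(a, i)` such that `q i` is dominated by `a` or its mate. An index `i`
occurs at least twice, with a dominating vertex and with its mate; a vertex `a` occurs at most four
times. -/
theorem IsDescent.length_le {lev : V → ℕ} {q : ℕ → V} {d : ℕ} (h : IsDescent G lev q d)
    {D : Finset V} (hD : IsPDSet G D) : d + 1 ≤ 2 * D.card := by
  classical
  obtain ⟨m, hm⟩ := hD.exists_mate
  let r : V → ℕ → Prop := fun a i => q i ∈ closedNbhd G a ∨ q i ∈ closedNbhd G (m a)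
  have hnear : ∀ {u v}, u ∈ closedNbhd G v → lev u ≤ lev v + 1 ∧ lev v ≤ lev u + 1 := by
    intro u v huv
    rcases mem_closedNbhd.1 huv with rfl | ha
    · omega
    · exact ⟨h.lev_le _ _ ha, h.lev_le _ _ ha.symm⟩
  have hup : ∀ a ∈ D, ((Finset.range (d + 1)).bipartiteAbove r a).card ≤ 4 := by
    intro a ha
    have hma := hnear (mem_closedNbhd.2 (Or.inr (hm a ha).2.1))
    let l := min (lev a) (lev (m a))
    -- The levels of `a` and its mate are in `{l, l + 1}`, so those of their neighbours are between
    -- `l - 1` and `l + 2`, and the path has only one vertex per level. Truncation at `l = 0` only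
    -- shrinks the interval.
    refine (Finset.card_le_card_of_injOn (fun i => lev (q i)) (t := Finset.Icc (l - 1) (l + 2))
      ?_ ?_).trans (by rw [Nat.card_Icc]; omega)
    · intro i hi
      obtain ⟨-, hi⟩ := Finset.mem_filter.1 hi
      simp only [Finset.coe_Icc, Set.mem_Icc]
      rcases hi with hi | hi
      · have := hnear hi
        omega
      · have := hnear hi
        omega
    · intro i hi j hj hij
      have hi := (Finset.mem_filter.1 hi).1
      have hj := (Finset.mem_filter.1 hj).1
      rw [Finset.mem_range] at hi hj
      have h1 := h.lev_eq i (by omega)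
      have h2 := h.lev_eq j (by omega)
      dsimp only at hij
      omega
  have hlow : ∀ i ∈ Finset.range (d + 1), 2 ≤ (D.bipartiteBelow r i).card := by
    intro i _
    obtain ⟨a, ha, hai⟩ := hD.1 (q i)
    have : ({a, m a} : Finset V) ⊆ D.bipartiteBelow r i := by
      intro b hb
      rw [Finset.mem_bipartiteBelow]
      rcases Finset.mem_insert.1 hb with rfl | hb
      · exact ⟨ha, Or.inl hai⟩
      · rw [Finset.mem_singleton.1 hb]
        refine ⟨(hm a ha).1, Or.inr ?_⟩
        rwa [(hm a ha).2.2]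
    calc 2 = ({a, m a} : Finset V).card := (Finset.card_pair (hm a ha).2.1.ne).symm
      _ ≤ _ := Finset.card_le_card this
  have h1 := Finset.sum_le_sum hlow
  have h2 := Finset.sum_le_sum hup
  rw [Finset.sum_card_bipartiteAbove_eq_sum_card_bipartiteBelow] at h2
  simp only [Finset.sum_const, Finset.card_range, smul_eq_mul] at h1 h2
  omega

theorem exists_isPerfectMatching_of_pairs {q : ℕ → V} {k : ℕ}
    (hinj : ∀ i < 2 * k, ∀ j < 2 * k, q i = q j → i = j)
    (hadj : ∀ j < k, G.Adj (q (2 * j)) (q (2 * j + 1))) {D : Finset V}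
    (hD : ∀ v, v ∈ D ↔ ∃ i < 2 * k, q i = v) :
    ∃ M : (G.induce (D : Set V)).Subgraph, M.IsPerfectMatching := by
  refine ⟨⟨Set.univ, fun a b => ∃ j < k, ((a : V) = q (2 * j) ∧ (b : V) = q (2 * j + 1)) ∨
    ((b : V) = q (2 * j) ∧ (a : V) = q (2 * j + 1)), ?_, fun _ => trivial, ?_⟩, ?_, fun _ => trivial⟩
  · rintro a b ⟨j, hj, ⟨ha, hb⟩ | ⟨hb, ha⟩⟩
    · rw [SimpleGraph.comap_adj]
      simpa [ha, hb] using hadj j hj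
    · rw [SimpleGraph.comap_adj]
      simpa [ha, hb] using (hadj j hj).symm
  · refine ⟨?_⟩
    rintro a b ⟨j, hj, h⟩
    exact ⟨j, hj, h.symm⟩
  · rintro ⟨a, ha⟩ -
    obtain ⟨i, hi, rfl⟩ := (hD a).1 ha
    obtain ⟨j, rfl | rfl⟩ := Nat.even_or_odd' i
    · refine ⟨⟨q (2 * j + 1), (hD _).2 ⟨_, by omega, rfl⟩⟩, ⟨j, by omega, Or.inl ⟨rfl, rfl⟩⟩, ?_⟩
      rintro ⟨b, hb⟩ ⟨l, hl, ⟨h1, h2⟩ | ⟨h1, h2⟩⟩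
      · have := hinj _ hi _ (by omega) h1
        obtain rfl : j = l := by omega
        exact Subtype.ext h2
      · have := hinj _ hi _ (by omega) h2
        omega
    · refine ⟨⟨q (2 * j), (hD _).2 ⟨_, by omega, rfl⟩⟩, ⟨j, by omega, Or.inr ⟨rfl, rfl⟩⟩, ?_⟩
      rintro ⟨b, hb⟩ ⟨l, hl, ⟨h1, h2⟩ | ⟨h1, h2⟩⟩
      · have := hinj _ hi _ (by omega) h1
        omega
      · have := hinj _ hi _ (by omega) h2
        obtain rfl : j = l := by omega
        exact Subtype.ext h1

/-- The length bound gives `d + 1 ≤ 2 * γ`. If the set has `d + 2` elements, then `d + 1` is odd and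
cannot equal the even right side, so one more is gained. -/
theorem card_le_of_descent {lev : V → ℕ} {q : ℕ → V} {d : ℕ} (h : IsDescent G lev q d)
    {D : Finset V} (hD : IsPDSet G D) (hle : D.card ≤ d + 2)
    (heven : D.card = d + 2 → Even d) : D.card ≤ 2 * pdNumber G := by
  obtain ⟨D', hD', hcard⟩ := Nat.sInf_mem (s := {k | ∃ D : Finset V, IsPDSet G D ∧ D.card = k})
    ⟨D.card, D, hD, rfl⟩
  have h1 := h.length_le hD'
  obtain ⟨l, hl⟩ := hD'.even_card
  change D'.card = pdNumber G at hcard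
  rw [← hcard]
  by_cases hc : D.card = d + 2
  · obtain ⟨k, hk⟩ := heven hc
    omega
  · omega

/-- The vertex set of a dominating descent, completed by a neighbour `w` of its end or with the end
removed if the parity requires it, is a small paired dominating set. -/
theorem IsDescent.isPDSet {lev : V → ℕ} {q : ℕ → V} {d : ℕ} (h : IsDescent G lev q d) (hd : 0 < d)
    (hdom : ∀ z, ∃ i ≤ d, z ∈ closedNbhd G (q i)) {D : Finset V}
    (hD : (Odd d ∧ ∀ v, v ∈ D ↔ ∃ i ≤ d, q i = v) ∨
      (Even d ∧ ∃ w, G.Adj (q d) w ∧ (∀ i ≤ d, q i ≠ w) ∧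
        ∀ v, v ∈ D ↔ (∃ i ≤ d, q i = v) ∨ v = w) ∨
      (Even d ∧ (∀ w, G.Adj (q d) w → ∃ i ≤ d, q i = w) ∧
        ∀ v, v ∈ D ↔ (∃ i ≤ d, q i = v) ∧ v ≠ q d)) :
    IsPDSet G D ∧ D.card ≤ 2 * pdNumber G := by
  classical
  have hcard : ∀ (q' : ℕ → V) (k : ℕ), (∀ v, v ∈ D ↔ ∃ i < k, q' i = v) → D.card ≤ k := by
    intro q' k hq'
    have : D = (Finset.range k).image q' := by
      ext v
      simp [hq']
    rw [this]
    exact Finset.card_image_le.trans (by simp)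
  rcases hD with ⟨⟨k, hk⟩, hD⟩ | ⟨⟨k, hk⟩, w, hw, hwq, hD⟩ | ⟨⟨k, hk⟩, hN, hD⟩
  · have hD' : ∀ v, v ∈ D ↔ ∃ i < 2 * (k + 1), q i = v := by
      intro v
      rw [hD]
      simp only [show ∀ i, i < 2 * (k + 1) ↔ i ≤ d by omega]
    have hPD : IsPDSet G D := by
      refine ⟨fun z => ?_, exists_isPerfectMatching_of_pairs (q := q) (k := k + 1)
        (fun i hi j hj hij => h.inj (by omega) (by omega) hij) (fun j hj => h.adj _ (by omega)) hD'⟩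
      obtain ⟨i, hi, hz⟩ := hdom z
      exact ⟨q i, (hD _).2 ⟨i, hi, rfl⟩, hz⟩
    have := hcard _ _ hD'
    exact ⟨hPD, card_le_of_descent h hPD (by omega) (by omega)⟩
  · have hq' : ∀ i ≤ d, Function.update q (d + 1) w i = q i := fun i hi =>
      Function.update_of_ne (by omega) _ _
    have hq'' : Function.update q (d + 1) w (d + 1) = w := Function.update_self _ _ _
    have hD' : ∀ v, v ∈ D ↔ ∃ i < 2 * (k + 1), Function.update q (d + 1) w i = v := by
      intro v
      rw [hD]
      constructor
      · rintro (⟨i, hi, rfl⟩ | rfl)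
        · exact ⟨i, by omega, hq' i hi⟩
        · exact ⟨d + 1, by omega, hq''⟩
      · rintro ⟨i, hi, rfl⟩
        rcases Nat.lt_or_ge d i with hdi | hdi
        · obtain rfl : i = d + 1 := by omega
          exact Or.inr hq''
        · exact Or.inl ⟨i, hdi, (hq' i hdi).symm⟩
    have hPD : IsPDSet G D := by
      refine ⟨fun z => ?_, exists_isPerfectMatching_of_pairs (k := k + 1)
        (fun i hi j hj hij => ?_) (fun j hj => ?_) hD'⟩
      · obtain ⟨i, hi, hz⟩ := hdom z
        exact ⟨q i, (hD _).2 (Or.inl ⟨i, hi, rfl⟩), hz⟩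
      · rcases Nat.lt_or_ge d i with hdi | hdi <;> rcases Nat.lt_or_ge d j with hdj | hdj
        · omega
        · obtain rfl : i = d + 1 := by omega
          rw [hq'', hq' j hdj] at hij
          exact absurd hij.symm (hwq j hdj)
        · obtain rfl : j = d + 1 := by omega
          rw [hq'', hq' i hdi] at hij
          exact absurd hij (hwq i hdi)
        · rw [hq' i hdi, hq' j hdj] at hij
          exact h.inj hdi hdj hij
      · rw [hq' (2 * j) (by omega)]
        by_cases hjd : 2 * j + 1 ≤ d
        · rw [hq' _ hjd]
          exact h.adj _ (by omega)
        · obtain rfl : d = 2 * j := by omega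
          rwa [hq'']
    have := hcard _ _ hD'
    exact ⟨hPD, card_le_of_descent h hPD (by omega) fun _ => ⟨k, hk⟩⟩
  · have hD' : ∀ v, v ∈ D ↔ ∃ i < 2 * k, q i = v := by
      intro v
      rw [hD]
      constructor
      · rintro ⟨⟨i, hi, rfl⟩, hne⟩
        refine ⟨i, ?_, rfl⟩
        have : i ≠ d := by rintro rfl; exact hne rfl
        omega
      · rintro ⟨i, hi, rfl⟩
        refine ⟨⟨i, by omega, rfl⟩, fun he => ?_⟩
        have := h.inj (by omega) le_rfl he
        omega
    have hPD : IsPDSet G D := by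
      refine ⟨fun z => ?_, exists_isPerfectMatching_of_pairs (q := q) (k := k)
        (fun i hi j hj hij => h.inj (by omega) (by omega) hij) (fun j hj => h.adj _ (by omega)) hD'⟩
      have hself : ∀ i ≤ d, i ≠ d → q i ∈ D := fun i hi hne => (hD' _).2 ⟨i, by omega, rfl⟩
      obtain ⟨i, hi, hz⟩ := hdom z
      -- Without its end the path still dominates: the end is adjacent to `q (d - 1)`, and its
      -- neighbours all belong to the remaining path.
      by_cases hid : i = d
      · subst hid
        rcases mem_closedNbhd.1 hz with rfl | hz
        · refine ⟨q (i - 1), hself _ (by omega) (by omega), mem_closedNbhd.2 (Or.inr ?_)⟩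
          simpa [Nat.sub_add_cancel hd] using h.adj (i - 1) (by omega)
        · obtain ⟨j, hj, rfl⟩ := hN z hz
          refine ⟨q j, hself j hj ?_, mem_closedNbhd.2 (Or.inl rfl)⟩
          rintro rfl
          exact G.loopless.irrefl _ hz
      · exact ⟨q i, hself i hi hid, hz⟩
    have := hcard _ _ hD'
    exact ⟨hPD, card_le_of_descent h hPD (by omega) (by omega)⟩

end PairedDom

namespace WordRAM

variable {B n : ℕ} {adj : ℕ → List ℕ}

/-! ## The path

Registers: `17` current vertex of the path, `18` parity of the number of its vertices so far.
Array `2` receives the output. -/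

/-- Put a marked vertex into register `17`. -/
def findMarked : Prog :=
  .seq (.const 7 0) <| .range 7 0 <| .seq (.load 12 3 7) <| .ite (.eq 12 1) (.move 17 7) .skip

/-- Output the path from the vertex in register `17` along the parents. -/
def tracePath : Prog :=
  .seq (.const 18 1) <| .seq (.store 2 17 1) <| .seq (.load 12 7 17) <|
    .loop (.lt 2 12) <| .seq (.sub 17 12 1) <| .seq (.store 2 17 1) <| .seq (.sub 18 1 18) <|
      .load 12 7 17

/-- If the path has an odd number of vertices, output also a neighbour of its end, or remove its end
from the output if there is no new neighbour. -/
def fixParity : Prog :=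
  .ite (.eq 18 1)
    (.seq (.move 8 17) <| .seq (.move 13 0) <|
      .seq (scanAdj (.seq (.load 12 2 11) <| .ite (.eq 12 2) (.move 13 11) .skip)) <|
      .ite (.eq 13 0) (.store 2 8 2) (.store 2 13 1))
    .skip

/-- The algorithm. -/
def pairedDomination : Prog :=
  .seq (.const 1 1) <| .seq (.store 3 2 1) <| .seq refineSet <| .seq refineSet <|
    .seq findMarked <| .seq tracePath fixParity

theorem findMarked_runs {Y : ℕ → Prop} {s : Mem} (hin : HasInput B n adj s) (hM : Marked n Y s)
    (hex : ∃ v, Y v) : Runs B findMarked s (n * 5 + 2) fun s' => Y (s'.reg 17) := by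
  have hBn := hin.succ_le
  unfold findMarked
  refine Runs.wp_seq (p := .const 7 0) (T := n * 5 + 1) ⟨by omega, ?_⟩
    (by simp [Prog.cost]; omega)
  refine (Runs.range (B := B) (ri := 7) (rk := 0) (s₀ := s.setReg 7 0)
    (body := .seq (.load 12 3 7) <| .ite (.eq 12 1) (.move 17 7) .skip)
    (fun i s' => (∃ v < i, Y v) → Y (s'.reg 17)) (fun _ => 3)
    (a := 0) (b := n) (by simp) (by simp [hin.reg0]) (by omega) (by omega) (by simp [hin.reg1])
    (by decide) (by decide) rfl rfl rfl (by simp) (by simp) ?_).mono (by simp) ?_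
  · intro i s' _ hi hf h7 hs'
    have h3 : s'.arr 3 = s.arr 3 := hf.arr 3 rfl
    have h1 : s'.reg 1 = 1 := (hf.reg 1 rfl).trans hin.reg1
    refine Runs.of_wp (p := .seq (.load 12 3 7) <| .ite (.eq 12 1) (.move 17 7) .skip) ?_
    by_cases hY : Y i
    · simp [Prog.wp, Test.Holds, h7, h3, h1, hM.flag i hY]
      exact ⟨by omega, by omega, fun _ _ _ => hY⟩
    · simp [Prog.wp, Test.Holds, h7, h3, h1, hM.flag' i hY]
      intro v hv hYv
      refine hs' ⟨v, lt_of_le_of_ne hv ?_, hYv⟩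
      rintro rfl
      exact hY hYv
  · rintro s' - h
    obtain ⟨v, hv⟩ := hex
    exact h ⟨v, hM.lt v hv, hv⟩

/-- The path that starts in `y` and follows the parents. -/
def parentPath (p : ℕ → ℕ) (y i : ℕ) : ℕ := (fun v => p v - 1)^[i] y

theorem parentPath_succ (p : ℕ → ℕ) (y i : ℕ) :
    parentPath p y (i + 1) = p (parentPath p y i) - 1 :=
  Function.iterate_succ_apply' _ _ _

/-- A vertex of positive level is outside the base, so its parent entry is nonzero and points one
level down. -/
theorem IsLevel.parentPath_spec (hA : AdjLists n adj) {X : ℕ → Prop} {p lev : ℕ → ℕ}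
    (h : IsLevel n adj X p lev) {y : ℕ} (hy : y < n) (i : ℕ) (hi : i ≤ lev y) :
    parentPath p y i < n ∧ lev (parentPath p y i) + i = lev y ∧
      (i < lev y → parentPath p y (i + 1) ∈ adj (parentPath p y i) ∧
        p (parentPath p y i) = parentPath p y (i + 1) + 1) := by
  have key : ∀ v < n, 0 < lev v → p v - 1 ∈ adj v ∧ p v = p v - 1 + 1 ∧ lev v = lev (p v - 1) + 1 := by
    intro v hv h0
    obtain ⟨t, ht, h1, h2⟩ := h.parent v hv fun hX => by
      have := (h.base v hX).1
      omega
    obtain rfl : t = p v - 1 := by omega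
    exact ⟨ht, h1, h2⟩
  induction i with
  | zero =>
    refine ⟨hy, rfl, fun h0 => ?_⟩
    obtain ⟨h1, h2, -⟩ := key y hy h0
    exact ⟨h1, h2⟩
  | succ i ih =>
    obtain ⟨h1, h2, -⟩ := ih (by omega)
    obtain ⟨h3, h4, h5⟩ := key _ h1 (by omega)
    rw [← parentPath_succ] at h3 h5
    refine ⟨hA.lt h3, by omega, fun hlt => ?_⟩
    obtain ⟨h6, h7, -⟩ := key _ (hA.lt h3) (by omega)
    rw [← parentPath_succ] at h6 h7
    exact ⟨h6, h7⟩

theorem IsLevel.parentPath_end (hA : AdjLists n adj) {X : ℕ → Prop} {p lev : ℕ → ℕ}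
    (h : IsLevel n adj X p lev) {y : ℕ} (hy : y < n) : X (parentPath p y (lev y)) := by
  obtain ⟨h1, h2, -⟩ := h.parentPath_spec hA hy (lev y) le_rfl
  by_contra hX
  obtain ⟨t, -, -, h3⟩ := h.parent _ h1 hX
  omega

/-- The vertices of the parent path have distinct levels; hence the path has at most `n` vertices
and can be traced in linear time. -/
theorem IsLevel.lt (hA : AdjLists n adj) {X : ℕ → Prop} {p lev : ℕ → ℕ}
    (h : IsLevel n adj X p lev) {y : ℕ} (hy : y < n) : lev y < n := by
  have := Finset.card_le_card_of_injOn (s := Finset.range (lev y + 1)) (t := Finset.range n)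
    (parentPath p y) (fun i hi => ?_) (fun i hi j hj hij => ?_)
  · simpa using this
  · simp only [Finset.coe_range, Set.mem_Iio] at hi ⊢
    exact (h.parentPath_spec hA hy i (by omega)).1
  · simp only [Finset.coe_range, Set.mem_Iio] at hi hj
    have h1 := (h.parentPath_spec hA hy i (by omega)).2.1
    have h2 := (h.parentPath_spec hA hy j (by omega)).2.1
    rw [hij] at h1
    omega

theorem tracePath_runs {X : ℕ → Prop} {s : Mem} (hA : AdjLists n adj) (hin : HasInput B n adj s)
    {lev p : ℕ → ℕ} (hp : s.arr 7 = p) (hpn : ∀ v, p v ≤ n) (hl : IsLevel n adj X p lev) {y : ℕ}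
    (hy : s.reg 17 = y) (hyn : y < n) (h2 : ∀ v, s.arr 2 v = 0) :
    Runs B tracePath s (n * 5 + 4) fun s' => s'.reg 17 = parentPath p y (lev y) ∧
      s'.reg 18 = (lev y + 1) % 2 ∧
      ∀ v, ((∃ i ≤ lev y, parentPath p y i = v) → s'.arr 2 v = 1) ∧
        ((∀ i ≤ lev y, parentPath p y i ≠ v) → s'.arr 2 v = 0) := by
  have hBn := hin.succ_le
  have hspec := hl.parentPath_spec hA hyn
  have hlev := hl.lt hA hyn
  have hy' := hpn y
  unfold tracePath
  refine Runs.wp_seq (p := .const 18 1) (T := lev y * 5 + 3) ⟨by omega, ?_⟩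
    (by simp [Prog.cost]; omega)
  refine Runs.wp_seq (p := .store 2 17 1) (T := lev y * 5 + 2) ⟨by simp [hin.reg1]; omega, ?_⟩
    (by simp [Prog.cost]; omega)
  refine Runs.wp_seq (p := .load 12 7 17) (T := lev y * 5 + 1) ⟨by simp [hp, hy]; omega, ?_⟩
    (by simp [Prog.cost]; omega)
  set s₀ := (((s.setReg 18 1).setArr 2 ((s.setReg 18 1).reg 17) ((s.setReg 18 1).reg 1)).setReg 12 _)
    with hs₀
  have hin₀ : HasInput B n adj s₀ := by
    refine hin.frame (p := .seq (.const 18 1) (.seq (.store 2 17 1) (.load 12 7 17)))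
      ⟨fun x hx => ?_, fun a ha => ?_⟩ rfl rfl rfl rfl rfl
    · simp [Prog.writesReg] at hx
      simp [hs₀, hx]
    · simp [Prog.writesArr] at ha
      simp [hs₀, ha]
  have hp₀ : s₀.arr 7 = p := by simp [hs₀, hp]
  have hΦ : lev (s₀.reg 17) * 5 = lev y * 5 := by simp [hs₀, hy]
  rw [← hΦ]
  refine (Runs.loop (B := B) (s₀ := s₀) (fun s' => ∃ i ≤ lev y, s'.reg 17 = parentPath p y i ∧
      s'.reg 18 = (i + 1) % 2 ∧ s'.reg 12 = p (parentPath p y i) ∧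
      ∀ v, ((∃ j ≤ i, parentPath p y j = v) → s'.arr 2 v = 1) ∧
        ((∀ j ≤ i, parentPath p y j ≠ v) → s'.arr 2 v = 0))
    (fun s' => lev (s'.reg 17) * 5) ?_ ?_).mono le_rfl ?_
  · refine ⟨0, by omega, ?_, ?_, ?_, fun v => ?_⟩
    · simp [hs₀, hy, parentPath]
    · simp [hs₀]
    · simp [hs₀, hp, hy, parentPath]
    · simp only [nonpos_iff_eq_zero, exists_eq_left, forall_eq]
      simp only [hs₀, Mem.setReg_arr, Mem.setArr_arr, if_true, Mem.setReg_reg, hy,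
        Function.update_apply, h2]
      norm_num
      rw [hin.reg1]
      simp only [parentPath, Function.iterate_zero, id]
      exact ⟨fun h => by simp [h], fun h => by simp [Ne.symm h]⟩
  · rintro s₁ hf ⟨i, hi, h17, h18, h12, hv⟩ hb
    have hr1 : s₁.reg 1 = 1 := (hf.reg 1 rfl).trans hin₀.reg1
    have hr2 : s₁.reg 2 = 0 := (hf.reg 2 rfl).trans hin₀.reg2
    have h7 : s₁.arr 7 = p := (hf.arr 7 rfl).trans hp₀
    have hpos : 0 < p (parentPath p y i) := by simpa [Test.Holds, hr2, h12] using hb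
    -- The path reaches the base at index `lev y`, and there the parent entry is zero.
    have hlt : i < lev y := by
      refine lt_of_le_of_ne hi ?_
      rintro rfl
      have := (hl.base _ (hl.parentPath_end hA hyn)).2
      omega
    obtain ⟨hn1, hl1, hstep⟩ := hspec i hi
    obtain ⟨hadj, hpe⟩ := hstep hlt
    obtain ⟨hn2, hl2, -⟩ := hspec (i + 1) hlt
    have hpp := hpn (parentPath p y (i + 1))
    have hpi := hpn (parentPath p y i)
    refine ⟨4, (Runs.of_wp (p := .seq (.sub 17 12 1) <| .seq (.store 2 17 1) <|
      .seq (.sub 18 1 18) <| .load 12 7 17) ?_).mono (by simp [Prog.cost]) (fun _ _ h => h)⟩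
    have he : s₁.reg 12 - s₁.reg 1 = parentPath p y (i + 1) := by rw [h12, hr1, hpe]; simp
    simp only [Prog.wp, Mem.setReg_reg, Mem.setArr_reg, Mem.setReg_arr, Mem.setArr_arr, he]
    norm_num
    rw [hr1, h18, h7]
    refine ⟨by omega, by omega, by omega, by omega, ⟨i + 1, hlt, rfl, by omega, rfl, fun v => ?_⟩,
      ?_⟩
    · rw [Function.update_apply]
      constructor
      · rintro j hj rfl
        split_ifs with hc
        · rfl
        · refine (hv _).1 ⟨j, ?_, rfl⟩
          have : j ≠ i + 1 := by rintro rfl; exact hc rfl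
          omega
      · intro h
        rw [if_neg fun hc => h (i + 1) le_rfl hc.symm]
        exact (hv v).2 fun j hj => h j (by omega)
    · rw [h17]
      omega
  · rintro s₁ hf ⟨⟨i, hi, h17, h18, h12, hv⟩, hb⟩
    have hr2 : s₁.reg 2 = 0 := (hf.reg 2 rfl).trans hin₀.reg2
    have hpos : p (parentPath p y i) = 0 := by simpa [Test.Holds, hr2, h12] using hb
    obtain rfl : i = lev y := by
      refine le_antisymm hi (not_lt.1 fun hlt => ?_)
      have := ((hspec i hi).2.2 hlt).2
      omega
    exact ⟨h17, h18, hv⟩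

theorem fixParity_runs {s : Mem} (hA : AdjLists n adj) (hin : HasInput B n adj s) {d : ℕ}
    {q : ℕ → ℕ} (hq : ∀ i ≤ d, q i < n) (h17 : s.reg 17 = q d) (h18 : s.reg 18 = (d + 1) % 2)
    (h2 : ∀ v, ((∃ i ≤ d, q i = v) → s.arr 2 v = 1) ∧ ((∀ i ≤ d, q i ≠ v) → s.arr 2 v = 0)) :
    Runs B fixParity s ((adj (q d)).length * 6 + 9) fun s' =>
      (Odd d ∧ ∀ v, s'.arr 2 v = 1 ↔ ∃ i ≤ d, q i = v) ∨
      (Even d ∧ ∃ w ∈ adj (q d), (∀ i ≤ d, q i ≠ w) ∧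
        ∀ v, s'.arr 2 v = 1 ↔ (∃ i ≤ d, q i = v) ∨ v = w) ∨
      (Even d ∧ (∀ w ∈ adj (q d), ∃ i ≤ d, q i = w) ∧
        ∀ v, s'.arr 2 v = 1 ↔ (∃ i ≤ d, q i = v) ∧ v ≠ q d) := by
  have hBn := hin.succ_le
  have hqd := hq d le_rfl
  have h2' : ∀ v, s.arr 2 v = 1 ↔ ∃ i ≤ d, q i = v := by
    intro v
    refine ⟨fun h => ?_, (h2 v).1⟩
    by_contra! hc
    rw [(h2 v).2 hc] at h
    omega
  have h20 : ∀ v, s.arr 2 v = 0 ↔ ∀ i ≤ d, q i ≠ v := by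
    intro v
    refine ⟨fun h => ?_, (h2 v).2⟩
    by_contra! hc
    rw [(h2 v).1 hc] at h
    omega
  unfold fixParity
  refine Runs.ite (T := (adj (q d)).length * 6 + 8) (fun hb => ?_) (fun hb => ?_)
  · have hd : Even d := by
      rw [Test.Holds, h18, hin.reg1] at hb
      rw [Nat.even_iff]
      omega
    refine Runs.wp_seq (p := .move 8 17) (T := (adj (q d)).length * 6 + 7)
      ⟨by omega, ?_⟩ (by simp [Prog.cost]; omega)
    refine Runs.wp_seq (p := .move 13 0) (T := (adj (q d)).length * 6 + 6)
      ⟨by simp [hin.reg0]; omega, ?_⟩ (by simp [Prog.cost]; omega)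
    set s₀ := (s.setReg 8 (s.reg 17)).setReg 13 ((s.setReg 8 (s.reg 17)).reg 0) with hs₀
    have hin₀ : HasInput B n adj s₀ := by
      refine hin.frame (p := .seq (.move 8 17) (.move 13 0)) ⟨fun x hx => ?_, fun _ _ => rfl⟩
        rfl rfl rfl rfl rfl
      simp [Prog.writesReg] at hx
      simp [hs₀, hx]
    have h8 : s₀.reg 8 = q d := by simp [hs₀, h17]
    -- Register `13` starts with `n`, which is no vertex and means that no neighbour off the path
    -- has been found.
    refine (Runs.scanAdj (body := .seq (.load 12 2 11) <| .ite (.eq 12 2) (.move 13 11) .skip)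
      hA hin₀ h8 hqd (fun m s' => (s'.reg 13 = n ∧ ∀ w ∈ m, s.arr 2 w ≠ 0) ∨
        s'.reg 13 ∈ adj (q d) ∧ s.arr 2 (s'.reg 13) = 0) 3 rfl rfl rfl rfl ?_ (by simp) ?_).seq
      (T₂ := 2) ?_ (by omega)
    · exact Or.inl ⟨by simp [hs₀, hin.reg0], by simp⟩
    · intro m v m' s₁ hm hf hs₁ hv
      have hvd : v ∈ adj (q d) := by rw [hm]; simp
      have hvn := hA.lt hvd
      have h2₁ : s₁.arr 2 = s.arr 2 := (hf.arr 2 rfl).trans rfl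
      have hr2 : s₁.reg 2 = 0 := (hf.reg 2 rfl).trans hin₀.reg2
      refine Runs.of_wp (p := .seq (.load 12 2 11) <| .ite (.eq 12 2) (.move 13 11) .skip) ?_
      by_cases hc : s.arr 2 v = 0
      · simp [Prog.wp, Test.Holds, hv, h2₁, hr2, hc]
        exact ⟨by omega, Or.inr hvd⟩
      · have h1 : s.arr 2 v = 1 := (h2 v).1 (by
          by_contra! hcon
          exact hc ((h2 v).2 hcon))
        simp [Prog.wp, Test.Holds, hv, h2₁, hr2, h1]
        refine ⟨by omega, hs₁.imp_left fun h => ⟨h.1, ?_⟩⟩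
        rintro w (hw | rfl)
        exacts [h.2 w hw, hc]
    · intro s₁ hf hs₁
      have h2₁ : s₁.arr 2 = s.arr 2 := (hf.arr 2 rfl).trans rfl
      have hin₁ := hin₀.frame hf rfl rfl rfl rfl rfl
      have h8₁ : s₁.reg 8 = q d := (hf.reg 8 rfl).trans h8
      refine Runs.ite (T := 1) (fun hc => ?_) (fun hc => ?_)
      · have hn : s₁.reg 13 = n := by simpa [Test.Holds, hin₁.reg0] using hc
        refine Runs.of_wp (p := .store 2 8 2) ⟨by simp [hin₁.reg2], Or.inr (Or.inr ⟨hd, ?_, ?_⟩)⟩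
        · rcases hs₁ with ⟨-, h⟩ | ⟨h, -⟩
          · intro w hw
            have := h w hw
            rw [Ne, h20] at this
            push Not at this
            exact this
          · exact absurd (hA.lt h) (by omega)
        · intro v
          rw [Mem.setArr_arr, if_pos rfl, Function.update_apply, h8₁, h2₁, hin₁.reg2]
          split_ifs with hv
          · simp [hv]
          · rw [h2']
            simp [hv]
      · have hn : s₁.reg 13 ≠ n := by simpa [Test.Holds, hin₁.reg0] using hc
        obtain ⟨hw, hw0⟩ := hs₁.resolve_left fun h => hn h.1
        refine Runs.of_wp (p := .store 2 13 1) ⟨by rw [hin₁.reg1]; omega,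
          Or.inr (Or.inl ⟨hd, _, hw, (h20 _).1 hw0, fun v => ?_⟩)⟩
        rw [Mem.setArr_arr, if_pos rfl, Function.update_apply, h2₁, hin₁.reg1]
        split_ifs with hv
        · simp [hv]
        · rw [h2']
          simp [hv]
  · refine ⟨s, 1, .skip s, by omega, Or.inl ⟨?_, h2'⟩⟩
    rw [Test.Holds, h18, hin.reg1] at hb
    rw [Nat.odd_iff]
    omega

end WordRAM

namespace WordRAM

/-! ## The input -/

/-- The adjacency lists as lists of natural numbers. -/
def natLists {n : ℕ} (adj : Fin n → List (Fin n)) (t : ℕ) : List ℕ :=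
  if h : t < n then (adj ⟨t, h⟩).map Fin.val else []

variable {n : ℕ} {adj : Fin n → List (Fin n)} {G : SimpleGraph (Fin n)}

@[simp] theorem natLists_val (adj : Fin n → List (Fin n)) (v : Fin n) :
    natLists adj v = (adj v).map Fin.val := by
  simp [natLists]

theorem mem_natLists (h : IsAdjacencyList G adj) {u v : Fin n} :
    (v : ℕ) ∈ natLists adj u ↔ G.Adj u v := by
  rw [natLists_val, List.mem_map_of_injective Fin.val_injective, (h u).2]

theorem exists_of_mem_natLists {t v : ℕ} (h : v ∈ natLists adj t) :
    ∃ a b : Fin n, (a : ℕ) = t ∧ (b : ℕ) = v := by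
  by_cases ht : t < n
  · rw [natLists, dif_pos ht, List.mem_map] at h
    obtain ⟨b, -, hb⟩ := h
    exact ⟨⟨t, ht⟩, b, rfl, hb⟩
  · simp [natLists, ht] at h

theorem adjLists_natLists (h : IsAdjacencyList G adj) : AdjLists n (natLists adj) := by
  refine ⟨fun t => ?_, fun {t v} hv => ?_, fun {t v} hv => ?_, fun t ht => ?_⟩
  · by_cases ht : t < n
    · rw [natLists, dif_pos ht]
      exact (h _).1.map Fin.val_injective
    · simp [natLists, ht]
  · obtain ⟨a, b, rfl, rfl⟩ := exists_of_mem_natLists hv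
    exact b.2
  · obtain ⟨a, b, rfl, rfl⟩ := exists_of_mem_natLists hv
    rw [mem_natLists h] at hv ⊢
    exact hv.symm
  · obtain ⟨a, b, rfl, -⟩ := exists_of_mem_natLists ht
    rw [mem_natLists h] at ht
    exact G.loopless.irrefl _ ht

theorem length_natLists (h : IsAdjacencyList G adj) [DecidableRel G.Adj] (v : Fin n) :
    (natLists adj v).length = G.degree v := by
  rw [natLists_val, List.length_map, ← List.toFinset_card_of_nodup (h v).1,
    ← SimpleGraph.card_neighborFinset_eq_degree]
  congr 1
  ext w
  simp [(h v).2]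

/-- The handshake lemma: the total length of the lists is what the sweeps pay for. -/
theorem volume_range (h : IsAdjacencyList G adj) :
    volume (natLists adj) (List.range n) = 2 * G.edgeSet.ncard := by
  classical
  have hsum : volume (natLists adj) (List.range n) =
      ∑ t ∈ Finset.range n, (natLists adj t).length := List.length_flatMap
  rw [hsum, Finset.sum_range]
  simp only [length_natLists h]
  rw [G.sum_degrees_eq_twice_card_edges, Set.ncard_eq_toFinset_card']
  rfl

theorem getElem?_flatten {α : Type*} (L : List (List α)) (t j : ℕ) (ht : t < L.length)
    (hj : j < L[t].length) :
    L.flatten[((L.take t).map List.length).sum + j]? = some L[t][j] := by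
  induction L generalizing t with
  | nil => simp at ht
  | cons l L ih =>
    cases t with
    | zero =>
      simp only [List.getElem_cons_zero] at hj
      simp [List.getElem?_append_left hj, List.getElem?_eq_getElem hj]
    | succ t =>
      simp only [List.getElem_cons_succ] at hj
      simp only [List.take_succ_cons, List.map_cons, List.sum_cons, List.flatten_cons,
        List.getElem_cons_succ]
      rw [List.getElem?_append_right (by omega), ← ih t (by simpa using ht) hj]
      congr 1
      omega

theorem hasInput_inputMem {B : ℕ} (hB : n + 1 ≤ B)
    (hV : volume (natLists adj) (List.range n) ≤ B) :
    HasInput B n (natLists adj) ((inputMem adj).setReg 1 1) := by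
  have hoff : ∀ t ≤ n, ((inputMem adj).setReg 1 1).arr 0 t =
      volume (natLists adj) (List.range t) := by
    intro t ht
    simp only [Mem.setReg_arr, inputMem, if_true, if_pos ht, volume, List.length_flatMap]
    congr 1
    refine List.ext_getElem (by simp [ht]) fun i hi _ => ?_
    have : i < n := by simp at hi; omega
    simp [natLists, this]
  refine ⟨by simp [inputMem], by simp, by simp [inputMem], hB, fun t ht => ?_, fun t ht => ?_,
    fun t ht j hj => ?_⟩
  · rw [hoff t ht.le, hoff (t + 1) ht, List.range_succ, volume_append]
    simp [volume]
  · rw [hoff t ht]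
    exact (volume_le List.nodup_range fun v hv => (List.mem_range.1 hv).trans_le ht).trans hV
  · simp only [natLists, dif_pos ht, List.length_map] at hj
    have h1 := getElem?_flatten (List.ofFn adj) t j (by simpa using ht) (by simpa using hj)
    simp only [Mem.setReg_arr, inputMem, if_true, if_pos ht.le, one_ne_zero, if_false,
      List.getD_eq_getElem?_getD, List.getElem?_map]
    rw [h1]
    simp [natLists, ht]

theorem exists_adj_of_connected (hG : G.Connected) (h : IsAdjacencyList G adj) (X : ℕ → Prop)
    (hu : ∃ u < n, X u) (hv : ∃ v < n, ¬ X v) : ∃ u v, X u ∧ ¬ X v ∧ v ∈ natLists adj u := by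
  obtain ⟨u, hun, hu⟩ := hu
  obtain ⟨v, hvn, hv⟩ := hv
  by_contra! hc
  obtain ⟨P⟩ := hG.preconnected ⟨u, hun⟩ ⟨v, hvn⟩
  have key : ∀ {a b : Fin n} (P : G.Walk a b), X a → X b := by
    intro a b P
    induction P with
    | nil => exact id
    | cons hab P ih =>
      intro ha
      refine ih ?_
      by_contra hb
      exact hc _ _ ha hb ((mem_natLists h).2 hab)
  exact hv (key P hu)

theorem Refined.isFarModule {A S : ℕ → Prop} {p : ℕ → ℕ} (h : IsAdjacencyList G adj)
    (hR : Refined n (natLists adj) A S p) :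
    PairedDom.IsFarModule G {v | A v} {v | S v} := by
  refine ⟨Set.disjoint_left.2 fun v hv => hR.disj v hv, ?_, ?_⟩
  · intro t ht y hy y' hy' hty
    rw [← mem_natLists h] at hty ⊢
    exact hR.module t t.2 ht y y' hy hy' hty
  · obtain ⟨rk, hrk⟩ := hR.rank
    refine ⟨fun v => rk v, fun u hu huA y hy huy => ?_⟩
    obtain ⟨r, h1, h2, h3, h4⟩ := hrk u u.2 hu huA y hy (by rwa [mem_natLists h])
    have hr := (adjLists_natLists h).lt h2
    exact ⟨⟨r, hr⟩, h1, (mem_natLists (v := ⟨r, hr⟩) h).1 h2,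
      fun h' => h3 ((mem_natLists (u := ⟨r, hr⟩) h).2 h'), h4⟩

/-- With total list length `2m`, each of the two sweeps costs `80m + 44n + 6`. Finding `y` and
tracing its path cost `5n` each, and the parity correction at most `12m`, up to constants. -/
theorem pairedDomination_runs (hG : G.Connected) (hn : 2 ≤ n) (h : IsAdjacencyList G adj) {B : ℕ}
    (hBn : n + 1 ≤ B) (hV : 2 * G.edgeSet.ncard + 1 ≤ B) :
    Runs B pairedDomination (inputMem adj) (172 * G.edgeSet.ncard + 98 * n + 29) fun s =>
      ∃ (X Y : ℕ → Prop) (p p' lev : ℕ → ℕ) (y : ℕ), Y y ∧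
        Refined n (natLists adj) (fun v => v = 0) X p ∧ Refined n (natLists adj) X Y p' ∧
        IsLevel n (natLists adj) X p' lev ∧
        ((Odd (lev y) ∧ ∀ v, s.arr 2 v = 1 ↔ ∃ i ≤ lev y, parentPath p' y i = v) ∨
        (Even (lev y) ∧ ∃ w ∈ natLists adj (parentPath p' y (lev y)),
          (∀ i ≤ lev y, parentPath p' y i ≠ w) ∧
          ∀ v, s.arr 2 v = 1 ↔ (∃ i ≤ lev y, parentPath p' y i = v) ∨ v = w) ∨
        (Even (lev y) ∧ (∀ w ∈ natLists adj (parentPath p' y (lev y)),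
          ∃ i ≤ lev y, parentPath p' y i = w) ∧
          ∀ v, s.arr 2 v = 1 ↔ (∃ i ≤ lev y, parentPath p' y i = v) ∧
            v ≠ parentPath p' y (lev y))) := by
  have hvol := volume_range h
  have hA := adjLists_natLists h
  have hconn := exists_adj_of_connected hG h
  have hin := hasInput_inputMem (adj := adj) hBn (by omega)
  unfold pairedDomination
  refine Runs.wp_seq (p := .const 1 1) (T := 172 * G.edgeSet.ncard + 98 * n + 28)
    ⟨by omega, ?_⟩ (by simp [Prog.cost]; omega)
  refine Runs.wp_seq (p := .store 3 2 1) (T := 172 * G.edgeSet.ncard + 98 * n + 27)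
    ⟨by simp; omega, ?_⟩ (by simp [Prog.cost]; omega)
  rw [hin.reg2, hin.reg1]
  have hin₀ : HasInput B n (natLists adj) (((inputMem adj).setReg 1 1).setArr 3 0 1) :=
    hin.frame (p := .store 3 2 1) ⟨fun _ _ => rfl, fun a ha => by
      simp [Prog.writesArr] at ha
      simp [ha]⟩ rfl rfl rfl rfl rfl
  have hM₀ : Marked n (fun v => v = 0) (((inputMem adj).setReg 1 1).setArr 3 0 1) := by
    refine ⟨?_, ?_, ?_, ?_, ?_⟩
    · rintro v rfl
      omega
    · rintro v rfl
      simp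
    · intro v hv
      simp [inputMem, hv]
    · simp [inputMem]
    · simp [inputMem]
  refine (refineSet_runs hA hin₀ hconn (by omega) hM₀ ⟨1, by omega, by omega⟩ ⟨0, rfl⟩).seq
    (T₂ := 92 * G.edgeSet.ncard + 54 * n + 21) (fun s₁ hf₁ hs₁ => ?_) (by omega)
  obtain ⟨X, hMX, hX⟩ := hs₁
  have hin₁ := hin₀.frame hf₁ rfl rfl rfl rfl rfl
  refine (refineSet_runs hA hin₁ hconn (by omega) hMX
    ⟨0, by omega, fun h0 => hX.disj 0 h0 rfl⟩ hX.ex).seq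
    (T₂ := 12 * G.edgeSet.ncard + 10 * n + 15) (fun s₂ hf₂ hs₂ => ?_) (by omega)
  obtain ⟨Y, hMY, hY⟩ := hs₂
  have hin₂ := hin₁.frame hf₂ rfl rfl rfl rfl rfl
  refine (findMarked_runs hin₂ hMY hY.ex).seq
    (T₂ := 12 * G.edgeSet.ncard + 5 * n + 13) (fun s₃ hf₃ hy => ?_) (by omega)
  have hin₃ := hin₂.frame hf₃ rfl rfl rfl rfl rfl
  obtain ⟨lev, hlev⟩ := hY.level
  have hyn := hY.lt _ hy
  refine (tracePath_runs (X := X) hA hin₃ (hf₃.arr 7 rfl) hMY.par hlev rfl hyn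
    (fun v => ?_)).seq (T₂ := 12 * G.edgeSet.ncard + 9) (fun s₄ hf₄ hs₄ => ?_) (by omega)
  · rw [hf₃.arr 2 rfl, hf₂.arr 2 rfl, hf₁.arr 2 rfl]
    simp [inputMem]
  obtain ⟨h1, h2, h3⟩ := hs₄
  have hin₄ := hin₃.frame hf₄ rfl rfl rfl rfl rfl
  have hq := fun i hi => (hlev.parentPath_spec hA hyn i hi).1
  refine (fixParity_runs hA hin₄ hq h1 h2 h3).mono ?_ ?_
  -- The degree of the end of the path, viewed as the volume of a one-element list, is at most `2m`.
  · have := volume_le (adj := natLists adj) (Q := [parentPath (s₂.arr 7) (s₃.reg 17)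
      (lev (s₃.reg 17))]) (List.nodup_singleton _) (by simpa using hq _ le_rfl)
    simp only [volume, List.flatMap_singleton] at this
    simp only [volume] at hvol
    omega
  · rintro s₅ - hs₅
    exact ⟨X, Y, _, _, lev, _, hy, hX, hY, hlev, hs₅⟩

end WordRAM

/-! ### The theorem: from the run of the program to the graph -/

open PairedDom WordRAM in
theorem theorem2 :
    ∃ (P : WordRAM.Prog) (C : ℕ),
      ∀ (n : ℕ) (G : SimpleGraph (Fin n)) (adj : Fin n → List (Fin n)),
        G.Connected → (∀ v, ∃ w, G.Adj v w) → PairedDom.ATFree G →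
        WordRAM.IsAdjacencyList G adj →
        ∃ (s : WordRAM.Mem) (t : ℕ),
          WordRAM.Exec (C * (n + G.edgeSet.ncard)) P (WordRAM.inputMem adj) s t ∧
          t ≤ C * (n + G.edgeSet.ncard) ∧
          PairedDom.IsPDSet G (WordRAM.outputSet n s) ∧
          (WordRAM.outputSet n s).card ≤ 2 * PairedDom.pdNumber G := by
  -- The constant covers both the time `172m + 98n + 29` and the word bounds `n + 1` and `2m + 1`.
  refine ⟨pairedDomination, 200, fun n G adj hG hiso hAT h => ?_⟩
  have hn : 2 ≤ n := by
    obtain ⟨v⟩ := hG.nonempty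
    obtain ⟨w, hw⟩ := hiso v
    have := hw.ne
    rw [Ne, Fin.ext_iff] at this
    omega
  obtain ⟨s, t, he, ht, X, Y, p, p', lev, y, hy, hX, hY, hlev, hout⟩ :=
    pairedDomination_runs (B := 200 * (n + G.edgeSet.ncard)) hG hn h (by omega) (by omega)
  refine ⟨s, t, he, by omega, ?_⟩
  have hA := adjLists_natLists h
  have hyn := hY.lt y hy
  have hspec := hlev.parentPath_spec hA hyn
  have hmem : ∀ v : Fin n, v ∈ outputSet n s ↔ s.arr 2 v = 1 := by simp [outputSet]
  -- Beyond index `lev y` the parent path has no meaning; the value `y` there is arbitrary.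
  let q : ℕ → Fin n := fun i =>
    if hi : parentPath p' y i < n then ⟨parentPath p' y i, hi⟩ else ⟨y, hyn⟩
  have hq : ∀ i ≤ lev y, (q i : ℕ) = parentPath p' y i := fun i hi => by
    simp only [q, dif_pos (hspec i hi).1]
  have hex : ∀ v : Fin n, (∃ i ≤ lev y, parentPath p' y i = v) ↔ ∃ i ≤ lev y, q i = v := by
    intro v
    refine exists_congr fun i => and_congr_right fun hi => ?_
    rw [← hq i hi, Fin.ext_iff]
  have hdesc : IsDescent G (fun v => lev v) q (lev y) := by
    refine ⟨fun u v huv => hlev.le u u.2 v ((mem_natLists h).2 huv), fun i hi => ?_, fun i hi => ?_⟩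
    · simp only [hq i hi]
      exact (hspec i hi).2.1
    · rw [← mem_natLists h, hq i hi.le, hq (i + 1) hi]
      exact ((hspec i hi.le).2.2 hi).1
  have hX₀ : {v : Fin n | (v : ℕ) = 0} = {(⟨0, by omega⟩ : Fin n)} := by
    ext v
    simp [Fin.ext_iff]
  have hXm := hX.isFarModule h
  rw [hX₀] at hXm
  have hd : 0 < lev y := by
    obtain ⟨t, -, -, h1⟩ := hlev.parent y hyn (hY.disj y hy)
    omega
  have hdom := hdesc.dominating hAT hXm (hY.isFarModule h)
    (by simpa [hq 0 (by omega), parentPath] using hy)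
    (by simpa [hq _ le_rfl] using hlev.parentPath_end hA hyn) (fun x hx => (hlev.base x hx).1)
  refine hdesc.isPDSet hd hdom ?_
  rcases hout with ⟨hodd, h1⟩ | ⟨heven, w, hw, hwq, h1⟩ | ⟨heven, hN, h1⟩
  · exact Or.inl ⟨hodd, fun v => by rw [hmem, h1, hex]⟩
  · have hwn := hA.lt hw
    rw [← hq _ le_rfl] at hw
    refine Or.inr (Or.inl ⟨heven, ⟨w, hwn⟩, (mem_natLists (v := ⟨w, hwn⟩) h).1 hw,
      fun i hi he => hwq i hi ?_, fun v => ?_⟩)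
    · rw [← hq i hi, he]
    · rw [hmem, h1, hex, Fin.ext_iff]
  · refine Or.inr (Or.inr ⟨heven, fun w hw => ?_, fun v => ?_⟩)
    · rw [← hex]
      refine hN w ?_
      rwa [← hq _ le_rfl, mem_natLists h]
    · rw [hmem, h1, hex, ← hq _ le_rfl, Ne, Ne, Fin.ext_iff]
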